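/- **Conventions.** Let $k$ be a field of characteristic zero and $X$ a normal integral scheme locally of finite type over $k$. A *distribution* on a $k$-scheme is a quasi-coherent quotient $q:\Omega^1_{X/k}\twoheadrightarrow\mathscr F$; write $d_{\mathscr F}=q\circ d:\mathscr O_X\to\mathscr F$. It is a *foliation* if there is a dense open subset of $X$ on whose affine open subsets the exterior derivative of $\bigwedge^\bullet\Omega^1_{X/k}$ descends to $\bigwedge^\bullet\mathscr F$. The sheaf of *first integrals* is $\mathscr O_X^{\mathscr F}=\ker(d_{\mathscr F})\subseteq\mathscr O_X$, with stalks $\mathscr O_{X,y}^{\mathscr F}=\ker(d_{\mathscr F,y})$. With $\eta$ the generic point of $X$, the *rank* of $\mathscr F$ is $\dim_{\mathscr O_{X,\eta}}\mathscr F_\eta$, and $\mathscr F$ is *algebraically integrable* if its rank equals $\operatorname{tr.deg}(\mathscr O_{X,\eta}/\mathscr O_{X,\eta}^{\mathscr F})$. Its first integrals are *locally of finite type* if $\Gamma(U,\mathscr O_X^{\mathscr F})$ is a finitely generated $k$-algebra for every affine open $U\subseteq X$. A point $x\in X$ is *$\mathscr F$-stable*, with witness $U$, if $U\ni x$ is an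 affine open subset such that $U\to\operatorname{Spec}\Gamma(U,\mathscr O_X^{\mathscr F})$ is smooth of relative dimension $\operatorname{rank}\mathscr F$ with geometrically connected (in particular non-empty) fibres. A morphism of schemes is *universally separable* if every base change of it induces separable (not necessarily algebraic) residue field extensions at all points. Let $\mathscr G$ be a distribution on a $k$-scheme $U$. A *smooth algebraic leaf* of $(U,\mathscr G)$ over an algebraically closed field extension $L/k$ is a closed subscheme $Z\subseteq U\times_k\operatorname{Spec}L$, smooth and geometrically integral over $L$, such that the projection $f:Z\to U$ is universally separable and there is an isomorphism $f^*\mathscr G\cong\Omega^1_{Z/L}$ under which $f^*\Omega^1_{U/k}\to f^*\mathscr G$ corresponds to the canonical map $f^*\Omega^1_{U/k}\to\Omega^1_{Z/k}\to\Omega^1_{Z/L}$. A $k$-morphism $\pi:U\to V$ is a *geometric quotient* of $(U,\mathscr G)$ if 1. $\pi$ is $\mathscr G$-invariant: it is universally separable and the composite $\pi^*\Omega^1_{V/k}\to\Omega^1_{U/k}\to\mathscr G$ is zero; 2. for every algebraically closed field extension $L/k$, the assignment $y\mapsto U\times_V\operatorname{Spec}L\subseteq U\times_k\operatorname{Spec}L$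 is a well-defined bijection from the set $V(L)$ of $k$-morphisms $y:\operatorname{Spec}L\to V$ to the set of smooth algebraic leaves of $(U,\mathscr G)$ over $L$; 3. $\pi$ is universally open; 4. the sequence $0\to\pi^{-1}\mathscr O_V\to\mathscr O_U\to\mathscr G$, whose last map is $d_{\mathscr G}$, is exact. **Proposition.** Let $k$ be a field of characteristic zero, $X$ a normal integral scheme locally of finite type over $k$, and $\mathscr F$ a foliation on $X$ that is algebraically integrable and whose first integrals are locally of finite type. Let $x\in X$ be an $\mathscr F$-stable point with witness $U$, and put $V=\operatorname{Spec}\Gamma(U,\mathscr O_X^{\mathscr F})$. Then the canonical morphism $\pi:U\to V$ is a geometric quotient of $(U,\mathscr F|_U)$. In particular, for every $y\in U$ the natural map $\mathscr O_{V,\pi(y)}\to\mathscr O_{X,y}$ induces an isomorphism $\mathscr O_{V,\pi(y)}\cong\mathscr O_{X,y}^{\mathscr F}$. -/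

import Mathlib

open CategoryTheory CategoryTheory.Limits AlgebraicGeometry Opposite TopologicalSpace
open scoped ZeroObject

universe u

namespace Foliation

noncomputable section

/-! ### The cotangent sheaf -/

section Cotangent

variable {k : Type u} [CommRing k] {X : Scheme.{u}}

/-- The structure map `k → Γ(X, U)` of a scheme `X` over `Spec k`. -/
def scalarMap (p : X ⟶ Spec (CommRingCat.of k)) (U : X.Opens) : CommRingCat.of k ⟶ Γ(X, U) :=
  (Scheme.ΓSpecIso (CommRingCat.of k)).inv ≫ p.appTop ≫ X.presheaf.map (homOfLE le_top).op

theorem scalarMap_res (p : X ⟶ Spec (CommRingCat.of k)) {U V : X.Opens} (i : V ⟶ U) :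
    scalarMap p U ≫ X.presheaf.map i.op = scalarMap p V := by
  simp only [scalarMap, Category.assoc]
  rw [← Functor.map_comp]; rfl

theorem scalarMap_app {X Y : Scheme.{u}} (pY : Y ⟶ Spec (CommRingCat.of k)) (f : X ⟶ Y)
    (V : Y.Opens) : scalarMap (f ≫ pY) (f ⁻¹ᵁ V) = scalarMap pY V ≫ f.app V := by
  simp only [scalarMap, Category.assoc, Scheme.Hom.naturality, Scheme.Hom.comp_appTop]
  rfl

theorem scalarMap_tower {R : Type u} [CommRing R] {Z : Scheme.{u}}
    (r : Z ⟶ Spec (CommRingCat.of R)) (t : Spec (CommRingCat.of R) ⟶ Spec (CommRingCat.of k))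
    (U : Z.Opens) :
    scalarMap (r ≫ t) U = ((Scheme.ΓSpecIso (CommRingCat.of k)).inv ≫ t.appTop ≫
      (Scheme.ΓSpecIso (CommRingCat.of R)).hom) ≫ scalarMap r U := by
  simp only [scalarMap, Scheme.Hom.comp_appTop, Category.assoc, Iso.hom_inv_id_assoc]

theorem scalarMap_image (p : X ⟶ Spec (CommRingCat.of k)) (U : X.Opens)
    (W : (U : Scheme.{u}).Opens) :
    scalarMap (U.ι ≫ p) W ≫ (U.ι.appIso W).inv = scalarMap p (U.ι ''ᵁ W) := by
  rw [Iso.comp_inv_eq, Scheme.Hom.appIso_hom, ← Category.assoc, ← scalarMap_app]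
  exact (scalarMap_res (U.ι ≫ p) (eqToHom (U.ι.preimage_image_eq W).symm)).symm

/-- The structure maps `k → Γ(X, U)` as a morphism from the constant presheaf `k` to `𝒪_X`. -/
def scalarPresheafMap (p : X ⟶ Spec (CommRingCat.of k)) :
    (Functor.const (Opens X)ᵒᵖ).obj (CommRingCat.of k) ⟶ X.presheaf where
  app U := scalarMap p U.unop
  naturality U V i := by
    simp only [scalarMap, Functor.const_obj_map, Category.assoc]
    rw [← Functor.map_comp]; rfl

/-- The sheaf of differentials `Ω¹_{X/k}`: the sheafification of the presheaf of modules
`U ↦ Ω¹_{Γ(X, U)/k}`. -/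
def cotangentSheaf (p : X ⟶ Spec (CommRingCat.of k)) : X.Modules :=
  (PresheafOfModules.sheafification (𝟙 X.ringCatSheaf.obj)).obj
    (PresheafOfModules.DifferentialsConstruction.relativeDifferentials' (scalarPresheafMap p))

/-- `k`-linear derivations from `𝒪_X` to a sheaf of `𝒪_X`-modules `M`. -/
abbrev SheafDerivation (p : X ⟶ Spec (CommRingCat.of k)) (M : X.Modules) : Type u :=
  PresheafOfModules.Derivation' (M := M.val) (scalarPresheafMap p)

/-- The derivation `𝒪_X → Ω¹_{X/k} → M` attached to an `𝒪_X`-linear map `q : Ω¹_{X/k} ⟶ M`. -/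
def derivationOf {p : X ⟶ Spec (CommRingCat.of k)} {M : X.Modules} (q : cotangentSheaf p ⟶ M) :
    SheafDerivation p M :=
  PresheafOfModules.Derivation.postcomp
    (PresheafOfModules.DifferentialsConstruction.derivation' (scalarPresheafMap p))
    (PresheafOfModules.sheafificationHomEquiv (𝟙 X.ringCatSheaf.obj) q)

/-- The `𝒪_X`-linear map `Ω¹_{X/k} ⟶ M` induced by a `k`-linear derivation `𝒪_X → M`. -/
def cotangentDesc {p : X ⟶ Spec (CommRingCat.of k)} {M : X.Modules} (D : SheafDerivation p M) :
    cotangentSheaf p ⟶ M :=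
  (PresheafOfModules.sheafificationHomEquiv (𝟙 X.ringCatSheaf.obj)).symm
    ((PresheafOfModules.DifferentialsConstruction.isUniversal' (scalarPresheafMap p)).desc D)

theorem derivationOf_cotangentDesc {p : X ⟶ Spec (CommRingCat.of k)} {M : X.Modules}
    (D : SheafDerivation p M) : derivationOf (cotangentDesc D) = D :=
  (congrArg (PresheafOfModules.Derivation.postcomp
    (PresheafOfModules.DifferentialsConstruction.derivation' (scalarPresheafMap p)))
    (Equiv.apply_symm_apply _ _)).trans
    ((PresheafOfModules.DifferentialsConstruction.isUniversal' (scalarPresheafMap p)).fac D)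

theorem cotangentDesc_derivationOf {p : X ⟶ Spec (CommRingCat.of k)} {M : X.Modules}
    (q : cotangentSheaf p ⟶ M) : cotangentDesc (derivationOf q) = q := by
  refine (Equiv.symm_apply_eq _).2 ?_
  apply (PresheafOfModules.DifferentialsConstruction.isUniversal'
    (scalarPresheafMap p)).postcomp_injective
  exact (PresheafOfModules.DifferentialsConstruction.isUniversal' (scalarPresheafMap p)).fac _

variable {p : X ⟶ Spec (CommRingCat.of k)} {M : X.Modules} (q : cotangentSheaf p ⟶ M)

/-- For `q : Ω¹_{X/k} ⟶ M`, the composite `q ∘ d : Γ(X, U) → Γ(U, Ω¹_{X/k}) → Γ(U, M)`. -/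
def diff (U : X.Opens) : Γ(X, U) →+ Γ(M, U) := (derivationOf q).d (X := op U)

theorem diff_mul (U : X.Opens) (a b : Γ(X, U)) :
    diff q U (a * b) = a • diff q U b + b • diff q U a :=
  (derivationOf q).d_mul (X := op U) a b

theorem diff_res {U V : X.Opens} (i : V ⟶ U) (a : Γ(X, U)) :
    diff q V (X.presheaf.map i.op a) = M.presheaf.map i.op (diff q U a) :=
  (derivationOf q).d_map i.op a

theorem diff_scalar (U : X.Opens) (c : k) : diff q U (scalarMap p U c) = 0 :=
  (derivationOf q).d_app (X := op U) c

theorem diff_one (U : X.Opens) : diff q U 1 = 0 :=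
  (derivationOf q).d_one (op U)

theorem diff_cotangentDesc (D : SheafDerivation p M) (U : X.Opens) (a : Γ(X, U)) :
    diff (cotangentDesc D) U a = D.d (X := op U) a :=
  PresheafOfModules.Derivation.congr_d (derivationOf_cotangentDesc D) (X := op U) a

/-- The canonical map `Ω¹_{Z/k} ⟶ Ω¹_{Z/R}` for `Z → Spec R → Spec k`. -/
def relativeCotangentMap {R : Type u} [CommRing R] {Z : Scheme.{u}}
    (r : Z ⟶ Spec (CommRingCat.of R)) (t : Spec (CommRingCat.of R) ⟶ Spec (CommRingCat.of k)) :
    cotangentSheaf (r ≫ t) ⟶ cotangentSheaf r :=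
  cotangentDesc
    { d := fun {U} => (derivationOf (𝟙 (cotangentSheaf r))).d (X := U)
      d_mul := fun {U} a b => (derivationOf (𝟙 (cotangentSheaf r))).d_mul (X := U) a b
      d_map := fun {U V} i a => (derivationOf (𝟙 (cotangentSheaf r))).d_map i a
      d_app := fun {U} c => by
        have h := congr($(scalarMap_tower r t U.unop) c)
        exact (congrArg (diff (𝟙 (cotangentSheaf r)) U.unop) h).trans (diff_scalar _ _ _) }

/-- The canonical map `f^* Ω¹_{Y/k} ⟶ Ω¹_{X/k}` of a morphism `f : X ⟶ Y` over `Spec k`; it is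
adjoint to the map `Ω¹_{Y/k} ⟶ f_* Ω¹_{X/k}` with `d a ↦ d (f^# a)`. -/
def cotangentPullbackMap {X Y : Scheme.{u}} (pX : X ⟶ Spec (CommRingCat.of k))
    (pY : Y ⟶ Spec (CommRingCat.of k)) (f : X ⟶ Y) (hf : f ≫ pY = pX) :
    (Scheme.Modules.pullback f).obj (cotangentSheaf pY) ⟶ cotangentSheaf pX :=
  ((Scheme.Modules.pullbackPushforwardAdjunction f).homEquiv _ _).symm
    (cotangentDesc
      { d := fun {V} => (diff (𝟙 (cotangentSheaf pX)) (f ⁻¹ᵁ V.unop)).comp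
          (f.app V.unop).hom.toAddMonoidHom
        d_mul := fun {V} a b =>
          (congrArg (diff (𝟙 (cotangentSheaf pX)) (f ⁻¹ᵁ V.unop))
            (map_mul (f.app V.unop).hom a b)).trans (diff_mul _ _ _ _)
        d_map := fun {V W} i a => by
          have h := congr($(f.naturality i) a)
          exact (congrArg (diff (𝟙 (cotangentSheaf pX)) (f ⁻¹ᵁ W.unop)) h).trans
            (diff_res (𝟙 (cotangentSheaf pX)) ((Opens.map f.base).map i.unop) _)
        d_app := fun {V} c => by
          subst hf
          have h := congr($(scalarMap_app pY f V.unop) c)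
          exact (congrArg (diff (𝟙 (cotangentSheaf (f ≫ pY))) (f ⁻¹ᵁ V.unop)) h.symm).trans
            (diff_scalar _ _ _) })

/-- The restriction to an open subscheme `U` of `q : Ω¹_{X/k} ⟶ M`, that is the map
`Ω¹_{U/k} ⟶ M|_U` with `d a ↦ (q ∘ d) a`. -/
def restrictQuotient (U : X.Opens) :
    cotangentSheaf (U.ι ≫ p) ⟶ M.restrict U.ι :=
  cotangentDesc
    { d := fun {W} => (diff q (U.ι ''ᵁ W.unop)).comp
        (U.ι.appIso W.unop).inv.hom.toAddMonoidHom
      d_mul := fun {W} a b =>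
        (congrArg (diff q (U.ι ''ᵁ W.unop))
          (map_mul (U.ι.appIso W.unop).inv.hom a b)).trans (diff_mul _ _ _ _)
      d_map := fun {V W} i a => by
        have h := congr($(U.ι.appIso_inv_naturality i) a)
        exact (congrArg (diff q (U.ι ''ᵁ W.unop)) h).trans
          (diff_res q (U.ι.opensFunctor.map i.unop) _)
      d_app := fun {W} c => by
        have h := congr($(scalarMap_image p U W.unop) c)
        exact (congrArg (diff q (U.ι ''ᵁ W.unop)) h).trans (diff_scalar _ _ _) }

end Cotangent

/-! ### First integrals -/

section FirstIntegrals

variable {k : Type u} [CommRing k] {X : Scheme.{u}} {p : X ⟶ Spec (CommRingCat.of k)}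
  {M : X.Modules} (q : cotangentSheaf p ⟶ M)

/-- The stalk of a sheaf of modules at `x`, as a module over the local ring at `x`. -/
instance stalkModule (M : X.Modules) (x : X) :
    Module (X.presheaf.stalk x) (M.presheaf.stalk x) :=
  PresheafOfModules.instModuleCarrierStalkCommRingCatCarrierAbPresheafOpensCarrier
    (R := X.presheaf) M.val x

/-- The ring of first integrals over `U`: the kernel of `q ∘ d` on `Γ(X, U)`. -/
def firstIntegrals (U : X.Opens) : Subring Γ(X, U) where
  carrier := {a | diff q U a = 0}
  mul_mem' {a b} ha hb := by
    change diff q U (a * b) = 0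
    change diff q U a = 0 at ha
    change diff q U b = 0 at hb
    rw [diff_mul, ha, hb, smul_zero, smul_zero, add_zero]
  one_mem' := diff_one q U
  add_mem' {a b} ha hb := by
    change diff q U (a + b) = 0
    change diff q U a = 0 at ha
    change diff q U b = 0 at hb
    rw [map_add, ha, hb, add_zero]
  zero_mem' := map_zero _
  neg_mem' {a} ha := by
    change diff q U (-a) = 0
    change diff q U a = 0 at ha
    rw [map_neg, ha, neg_zero]

/-- The structure map of the `k`-algebra of first integrals over `U`. -/
def firstIntegralsScalar (U : X.Opens) : k →+* firstIntegrals q U :=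
  (scalarMap p U).hom.codRestrict (firstIntegrals q U) (diff_scalar q U)

/-- The spectrum of the ring of first integrals over `U`. -/
abbrev firstIntegralsSpec (U : X.Opens) : Scheme.{u} :=
  Spec (CommRingCat.of (firstIntegrals q U))

/-- The structure morphism `Spec Γ(U, 𝒪^F) ⟶ Spec k`. -/
def firstIntegralsSpecOver (U : X.Opens) : firstIntegralsSpec q U ⟶ Spec (CommRingCat.of k) :=
  Spec.map (CommRingCat.ofHom (firstIntegralsScalar q U))

/-- The morphism `U ⟶ Spec Γ(U, 𝒪_X) ⟶ Spec Γ(U, 𝒪^F)` induced by the inclusion of rings. -/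
def toFirstIntegralsSpec (U : X.Opens) : (U : Scheme.{u}) ⟶ firstIntegralsSpec q U :=
  U.toSpecΓ ≫ Spec.map (CommRingCat.ofHom (firstIntegrals q U).subtype)

theorem exists_nhd_diff_eq_zero (x : X) {s : X.presheaf.stalk x}
    (hs : ∃ (U : X.Opens) (hx : x ∈ U) (a : Γ(X, U)),
      X.presheaf.germ U x hx a = s ∧ M.presheaf.germ U x hx (diff q U a) = 0) :
    ∃ (U : X.Opens) (hx : x ∈ U) (a : Γ(X, U)),
      X.presheaf.germ U x hx a = s ∧ diff q U a = 0 := by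
  obtain ⟨U, hx, a, rfl, h⟩ := hs
  rw [← map_zero (M.presheaf.germ U x hx).hom] at h
  obtain ⟨W, hxW, i, j, e⟩ := M.presheaf.germ_eq x hx hx _ _ h
  refine ⟨W, hxW, X.presheaf.map i.op a, X.presheaf.germ_res_apply i x hxW a, ?_⟩
  rw [diff_res]
  exact e.trans (map_zero _)

theorem exists_common_nhd (x : X) {s t : X.presheaf.stalk x}
    (hs : ∃ (U : X.Opens) (hx : x ∈ U) (a : Γ(X, U)),
      X.presheaf.germ U x hx a = s ∧ M.presheaf.germ U x hx (diff q U a) = 0)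
    (ht : ∃ (U : X.Opens) (hx : x ∈ U) (a : Γ(X, U)),
      X.presheaf.germ U x hx a = t ∧ M.presheaf.germ U x hx (diff q U a) = 0) :
    ∃ (W : X.Opens) (hx : x ∈ W) (a b : Γ(X, W)), X.presheaf.germ W x hx a = s ∧
      X.presheaf.germ W x hx b = t ∧ diff q W a = 0 ∧ diff q W b = 0 := by
  obtain ⟨U, hxU, a, rfl, ha⟩ := exists_nhd_diff_eq_zero q x hs
  obtain ⟨V, hxV, b, rfl, hb⟩ := exists_nhd_diff_eq_zero q x ht
  refine ⟨U ⊓ V, ⟨hxU, hxV⟩, X.presheaf.map (homOfLE inf_le_left).op a,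
    X.presheaf.map (homOfLE inf_le_right).op b, X.presheaf.germ_res_apply _ x _ a,
    X.presheaf.germ_res_apply _ x _ b, ?_, ?_⟩
  · rw [diff_res, ha, map_zero]
  · rw [diff_res, hb, map_zero]

/-- The ring of local first integrals at `x`: the kernel of the map on stalks
`𝒪_{X,x} → M_x` induced by `q ∘ d`, which sends the germ of `a` to the germ of `(q ∘ d) a`. -/
def localFirstIntegrals (x : X) : Subring (X.presheaf.stalk x) where
  carrier := {s | ∃ (U : X.Opens) (hx : x ∈ U) (a : Γ(X, U)),
    X.presheaf.germ U x hx a = s ∧ M.presheaf.germ U x hx (diff q U a) = 0}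
  mul_mem' {s t} hs ht := by
    obtain ⟨W, hx, a, b, rfl, rfl, ha, hb⟩ := exists_common_nhd q x hs ht
    refine ⟨W, hx, a * b, map_mul _ _ _, ?_⟩
    rw [diff_mul, ha, hb, smul_zero, smul_zero, add_zero, map_zero]
  one_mem' := ⟨⊤, trivial, 1, map_one _, by rw [diff_one, map_zero]⟩
  add_mem' {s t} hs ht := by
    obtain ⟨W, hx, a, b, rfl, rfl, ha, hb⟩ := exists_common_nhd q x hs ht
    refine ⟨W, hx, a + b, map_add _ _ _, ?_⟩
    rw [map_add, ha, hb, add_zero, map_zero]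
  zero_mem' := ⟨⊤, trivial, 0, map_zero _, by rw [map_zero, map_zero]⟩
  neg_mem' {a} ha := by
    obtain ⟨U, hx, a, rfl, h⟩ := ha
    exact ⟨U, hx, -a, map_neg _ _, by rw [map_neg, map_neg, h, neg_zero]⟩

end FirstIntegrals

/-! ### Morphisms of directed spaces, leaves, quotients -/

section Directed

/-- A (possibly transcendental) field extension `K / k` is separable if every finitely generated
subextension is separably generated. -/
def IsSeparableExtension (k K : Type u) [Field k] [Field K] [Algebra k K] : Prop :=
  ∀ E : IntermediateField k K, E.FG → ∃ s : Set E,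
    IsTranscendenceBasis k ((↑) : s → E) ∧ Algebra.IsSeparable (IntermediateField.adjoin k s) E

/-- All residue field extensions `κ(f x) → κ(x)` are separable. -/
def residuallySeparable : MorphismProperty Scheme.{u} := fun X Y f =>
  ∀ x : X, letI := (f.residueFieldMap x).hom.toAlgebra
    IsSeparableExtension (Y.residueField (f x)) (X.residueField x)

/-- Every base change of `f` is residually separable. -/
def universallySeparable : MorphismProperty Scheme.{u} := residuallySeparable.universally

variable {k : Type u} [CommRing k] {X Y : Scheme.{u}} {pX : X ⟶ Spec (CommRingCat.of k)}
  {pY : Y ⟶ Spec (CommRingCat.of k)}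

/-- The morphism `f : X ⟶ Y` over `Spec k` is a morphism of directed spaces
`(X, F) ⟶ (Y, G)`, where `F` and `G` are quotients of the cotangent sheaves through `q` and `r`:
it is universally separable and the square formed by `f^* Ω¹_{Y/k} ⟶ Ω¹_{X/k}` can be completed
by a map `f^* G ⟶ F`. -/
def IsDirectedMorphism {F : X.Modules} {G : Y.Modules} (q : cotangentSheaf pX ⟶ F)
    (r : cotangentSheaf pY ⟶ G) (f : X ⟶ Y) (hf : f ≫ pY = pX) : Prop :=
  universallySeparable f ∧ ∃ φ : (Scheme.Modules.pullback f).obj G ⟶ F,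
    (Scheme.Modules.pullback f).map r ≫ φ = cotangentPullbackMap pX pY f hf ≫ q

/-- A morphism of directed spaces for which the induced map `f^* G ⟶ F` is an isomorphism. -/
def IsWeaklyEtaleDirectedMorphism {F : X.Modules} {G : Y.Modules} (q : cotangentSheaf pX ⟶ F)
    (r : cotangentSheaf pY ⟶ G) (f : X ⟶ Y) (hf : f ≫ pY = pX) : Prop :=
  universallySeparable f ∧ ∃ φ : (Scheme.Modules.pullback f).obj G ⟶ F, IsIso φ ∧
    (Scheme.Modules.pullback f).map r ≫ φ = cotangentPullbackMap pX pY f hf ≫ q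

/-- `f : (X, F) ⟶ (Y, 0)` is a morphism of directed spaces. -/
def IsInvariantMorphism {F : X.Modules} (q : cotangentSheaf pX ⟶ F) (f : X ⟶ Y)
    (hf : f ≫ pY = pX) : Prop :=
  IsDirectedMorphism q (0 : cotangentSheaf pY ⟶ (0 : Y.Modules)) f hf

/-- `i : Z ⟶ X ×_k T` with `T = Spec R` is a smooth family of algebraic leaves over `T` of the
distribution given by `q : Ω¹_{X/k} ⟶ F`. -/
structure IsSmoothFamilyOfLeaves {F : X.Modules} (q : cotangentSheaf pX ⟶ F)
    {R : Type u} [CommRing R] (t : Spec (CommRingCat.of R) ⟶ Spec (CommRingCat.of k))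
    {Z : Scheme.{u}} (i : Z ⟶ pullback pX t) : Prop where
  closedImmersion : IsClosedImmersion i
  smooth : Smooth (i ≫ pullback.snd pX t)
  geometricallyIntegral : GeometricallyIntegral (i ≫ pullback.snd pX t)
  weaklyEtale : IsWeaklyEtaleDirectedMorphism
    (relativeCotangentMap (i ≫ pullback.snd pX t) t) q (i ≫ pullback.fst pX t)
    (by rw [Category.assoc, Category.assoc, pullback.condition])

/-- `π : X ⟶ Y` represents the geometric points of the functor of smooth algebraic leaves: for
every algebraically closed field `L` and every `t : Spec L ⟶ Spec k`, the assignment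
`y ↦ X ×_Y Spec L ⊆ X ×_k Spec L` is a well-defined bijection from the set of `k`-morphisms
`y : Spec L ⟶ Y` to the set of (isomorphism classes of) smooth algebraic leaves over `L`. -/
structure RepresentsGeometricLeaves {F : X.Modules} (q : cotangentSheaf pX ⟶ F)
    (pY : Y ⟶ Spec (CommRingCat.of k)) (π : X ⟶ Y) (hπ : π ≫ pY = pX) : Prop where
  fibre_isLeaf : ∀ (L : Type u) [Field L] [IsAlgClosed L]
    (t : Spec (CommRingCat.of L) ⟶ Spec (CommRingCat.of k)) (y : Spec (CommRingCat.of L) ⟶ Y)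
    (hy : y ≫ pY = t),
    IsSmoothFamilyOfLeaves q t (pullback.lift (pullback.fst π y) (pullback.snd π y)
      (by rw [← hπ, ← hy, pullback.condition_assoc]))
  existsUnique_point : ∀ (L : Type u) [Field L] [IsAlgClosed L]
    (t : Spec (CommRingCat.of L) ⟶ Spec (CommRingCat.of k)) (Z : Scheme.{u})
    (i : Z ⟶ pullback pX t), IsSmoothFamilyOfLeaves q t i →
    ∃! y : Spec (CommRingCat.of L) ⟶ Y, y ≫ pY = t ∧
      IsPullback (i ≫ pullback.fst pX t) (i ≫ pullback.snd pX t) π y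

/-- `π : X ⟶ Y` is a geometric quotient, over `k`, of `X` by the distribution given by
`q : Ω¹_{X/k} ⟶ F`. Exactness of `0 → π⁻¹ 𝒪_Y → 𝒪_X → F` is expressed on stalks. -/
structure IsGeometricQuotient {F : X.Modules} (q : cotangentSheaf pX ⟶ F)
    (pY : Y ⟶ Spec (CommRingCat.of k)) (π : X ⟶ Y) : Prop where
  comp_eq : π ≫ pY = pX
  invariant : IsInvariantMorphism q π comp_eq
  representsLeaves : RepresentsGeometricLeaves q pY π comp_eq
  universallyOpen : UniversallyOpen π
  injective_stalkMap : ∀ x : X, Function.Injective (π.stalkMap x)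
  range_stalkMap : ∀ x : X, (π.stalkMap x).hom.range = localFirstIntegrals q x

end Directed

/-! ### Distributions and foliations -/

/-- A distribution on `X` over `k`: a quasi-coherent quotient of `Ω¹_{X/k}`. -/
structure Distribution {k : Type u} [CommRing k] {X : Scheme.{u}}
    (p : X ⟶ Spec (CommRingCat.of k)) where
  /-- the quotient sheaf -/
  sheaf : X.Modules
  /-- the quotient map -/
  quotientMap : cotangentSheaf p ⟶ sheaf
  epi : Epi quotientMap
  isQuasicoherent : sheaf.IsQuasicoherent

namespace Distribution

variable {k : Type u} [CommRing k] {X : Scheme.{u}} {p : X ⟶ Spec (CommRingCat.of k)}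
  (F : Distribution p)

/-- The exterior derivative descends to the exterior algebra of `F` over a dense open subset `W`.
The group `Ωⁿ` is generated by the forms `a db₁ ∧ ⋯ ∧ dbₙ`, whose exterior derivative is
`da ∧ db₁ ∧ ⋯ ∧ dbₙ`, so a map `δ` on `⋀ⁿ F` is induced by the exterior derivative if and only if
it is given by this formula on the classes of these forms. -/
def IsInvolutive : Prop :=
  ∃ W : X.Opens, Dense (W : Set X) ∧ ∀ U : X.Opens, IsAffineOpen U → U ≤ W → ∀ n : ℕ,
    ∃ δ : ⋀[Γ(X, U)]^n Γ(F.sheaf, U) →+ ⋀[Γ(X, U)]^(n + 1) Γ(F.sheaf, U),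
      ∀ (a : Γ(X, U)) (b : Fin n → Γ(X, U)),
        δ (a • exteriorPower.ιMulti Γ(X, U) n (fun i => diff F.quotientMap U (b i))) =
          exteriorPower.ιMulti Γ(X, U) (n + 1)
            (Fin.cons (diff F.quotientMap U a) (fun i => diff F.quotientMap U (b i)))

/-- The rank of `F`: the dimension of its generic stalk over the function field. -/
def rank [IsIntegral X] : ℕ :=
  Module.finrank (X.presheaf.stalk (genericPoint X)) (F.sheaf.presheaf.stalk (genericPoint X))

/-- The rank of `F` equals the transcendence degree of the function field over the field of
local first integrals at the generic point. -/
def IsAlgebraicallyIntegrable [IsIntegral X] : Prop :=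
  (F.rank : Cardinal.{u}) =
    Algebra.trdeg (localFirstIntegrals F.quotientMap (genericPoint X))
      (X.presheaf.stalk (genericPoint X))

/-- For every affine open `U`, the `k`-algebra of first integrals over `U` is of finite type. -/
def HasFiniteTypeFirstIntegrals : Prop :=
  ∀ U : X.Opens, IsAffineOpen U → (firstIntegralsScalar F.quotientMap U).FiniteType

/-- The open set `U` witnesses stability of its points: it is affine and
`U ⟶ Spec Γ(U, 𝒪^F)` is smooth of relative dimension `rank F` with geometrically connected
(in particular non-empty) fibres. -/
structure WitnessesStability [IsIntegral X] (U : X.Opens) : Prop where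
  isAffineOpen : IsAffineOpen U
  smooth : SmoothOfRelativeDimension F.rank (toFirstIntegralsSpec F.quotientMap U)
  geometricallyConnected : GeometricallyConnected (toFirstIntegralsSpec F.quotientMap U)

/-- The point `x` is `F`-stable. -/
def IsStable [IsIntegral X] (x : X) : Prop :=
  ∃ U : X.Opens, x ∈ U ∧ F.WitnessesStability U

end Distribution

end

end Foliation

/-!
# Stable points of an algebraically integrable foliation have geometric quotients

Put `A = Γ(U, 𝒪_X)`, `B = Γ(U, 𝒪_X^F) ⊆ A` and `π : U ⟶ Spec B`. The argument rests on the
identification of `F|_U` with the relative cotangent sheaf of `π` (`exists_cotangentSheaf_iso`).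
Indeed `q ∘ d` kills `B`, hence factors through an epimorphism `Ω¹_{U/B} ⟶ F|_U`. At the generic
point both sides have the same dimension, namely the relative dimension of `π`, so the epimorphism
is an isomorphism there; it is a monomorphism everywhere because `Ω¹_{U/B}` is locally free and `U`
is integral.

*Leaves.* Fibres of `π` over geometric points are smooth and connected, hence integral
(`isDomain_of_smooth_of_connectedSpace`), they are closed in `U ×_k Spec L`, and the cotangent sheaf
of a fibre is the pullback of `Ω¹_{U/B}`, so they are leaves
(`isSmoothFamilyOfLeaves_of_isPullback`). Conversely, first integrals have zero differential on a
leaf `Z` and so are constants there, as `L` is algebraically closed of characteristic zero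
(`isAlgebraic_of_D_eq_zero`). This gives a point `y : Spec L ⟶ Spec B` for which `Z` is a closed
subscheme of the fibre over `y` (`exists_point_comp_eq`). Restriction of differentials from the
fibre to `Z` is an isomorphism, so the conormal module of `Z` vanishes, and `Z` is the whole fibre
(`isPullback_of_isClosedImmersion`).

Isomorphisms `f^* G ≅ Ω¹_{Z/L}` are handled through the adjunction between pullback and direct image
and the universal property of differentials: they amount to statements on extension of derivations,
which on affine schemes concern global functions only (`exists_diff_top_eq`).

*First integrals.* An element of the function field of `U` with zero differential over `B` is
algebraic over `Frac B`, hence in `Frac B`, since the generic fibre of `π` is geometrically integral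
(`mem_range_algebraMap_of_isAlgebraic`). If it is regular at `x`, it is regular on the base at `π x`
by faithful flatness (`exists_algebraMap_eq_of_mul_eq`), which describes the stalks
(`range_stalkMap_eq`).

Separability of residue fields is automatic in characteristic zero, and `π` is universally open
since it is smooth. -/

open scoped TensorProduct

/-! ### Connected smooth algebras are domains -/

/-- A reduced artinian ring is a product of fields, so every `a` satisfies `a² x = a` for some `x`;
the idempotent is `a x`. -/
theorem exists_idempotent_of_isReduced_isArtinianRing {T : Type*} [CommRing T] [IsArtinianRing T]
    [IsReduced T] (a b : T) (hab : a * b = 0) :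
    ∃ e : T, IsIdempotentElem e ∧ e * a = a ∧ e * b = 0 := by
  classical
  have hvn : ∃ x, a * a * x = a := by
    let φ := IsArtinianRing.equivPi T
    have : ∀ I : MaximalSpectrum T, ∃ x : T ⧸ I.asIdeal, φ a I * φ a I * x = φ a I := by
      intro I
      let := Ideal.Quotient.field I.asIdeal
      by_cases h : φ a I = 0
      · exact ⟨0, by simp [h]⟩
      · exact ⟨(φ a I)⁻¹, by field_simp⟩
    choose x hx using this
    refine ⟨φ.symm x, φ.injective ?_⟩
    rw [map_mul, map_mul, φ.apply_symm_apply]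
    exact funext hx
  obtain ⟨x, hx⟩ := hvn
  refine ⟨a * x, ?_, ?_, ?_⟩
  · change a * x * (a * x) = a * x
    linear_combination x * hx
  · linear_combination hx
  · linear_combination x * hab

/-- An étale algebra `S` over a normal domain `P` is locally a domain. The generic fibre is a
product of fields, where an idempotent `e` separates `a` from `b`; being integral over `S`, it lies
in `S`, because integral closures commute with étale base change. -/
theorem exists_notMem_mul_eq_zero_of_etale {P S : Type*} [CommRing P] [IsDomain P]
    [IsIntegrallyClosed P] [CommRing S] [Algebra P S] [Algebra.Etale P S] (p : Ideal S)
    [p.IsPrime] (a b : S) (hab : a * b = 0) :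
    ∃ s ∉ p, s * a = 0 ∨ s * b = 0 := by
  let E := FractionRing P
  let : Algebra E (S ⊗[P] E) := Algebra.TensorProduct.rightAlgebra
  have : Algebra.Etale E (S ⊗[P] E) :=
    Algebra.Etale.of_equiv (Algebra.TensorProduct.commRight P E S)
  have : IsReduced (S ⊗[P] E) := Algebra.FormallyUnramified.isReduced_of_field E _
  have : Module.Finite E (S ⊗[P] E) := Algebra.FormallyUnramified.finite_of_free E _
  have : IsArtinianRing (S ⊗[P] E) := IsArtinianRing.of_finite E _
  have : Algebra.Smooth P S := inferInstance
  have : Module.Flat P S := inferInstance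
  have hinj : Function.Injective (algebraMap S (S ⊗[P] E)) :=
    Algebra.TensorProduct.includeLeft_injective (R := P) (S := P) (A := S) (B := E)
      (IsFractionRing.injective P E)
  obtain ⟨e, he, hea, heb⟩ := exists_idempotent_of_isReduced_isArtinianRing
    (algebraMap S (S ⊗[P] E) a) (algebraMap S (S ⊗[P] E) b) (by rw [← map_mul, hab, map_zero])
  have hint : IsIntegral S e := by
    have : Nontrivial S := ⟨0, 1, fun h ↦ ‹p.IsPrime›.ne_top
      ((Ideal.eq_top_iff_one p).mpr (h ▸ p.zero_mem))⟩
    refine ⟨Polynomial.X ^ 2 - Polynomial.X, Polynomial.monic_X_pow_sub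
      (by rw [Polynomial.degree_X]; norm_num), ?_⟩
    simp [sq, he.eq]
  obtain ⟨t, ht⟩ := (TensorProduct.toIntegralClosure_bijective_of_smooth
    (R := P) (S := S) (B := E)).2 ⟨e, hint⟩
  have : ∃ s : S, algebraMap S (S ⊗[P] E) s = e := by
    have h2 : ∀ t : S ⊗[P] integralClosure P E, ∃ s : S, algebraMap S (S ⊗[P] E) s =
        (TensorProduct.toIntegralClosure P S E t : S ⊗[P] E) := by
      intro t
      induction t with
      | zero => exact ⟨0, by simp⟩
      | add x y hx hy =>
        obtain ⟨s, hs⟩ := hx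
        obtain ⟨s', hs'⟩ := hy
        exact ⟨s + s', by simp [hs, hs']⟩
      | tmul s y =>
        obtain ⟨c, hc⟩ := IsIntegrallyClosed.isIntegral_iff.mp y.2
        refine ⟨c • s, ?_⟩
        change (c • s) ⊗ₜ[P] (1 : E) = s ⊗ₜ[P] (y : E)
        rw [TensorProduct.smul_tmul, ← hc, Algebra.smul_def, mul_one]
    obtain ⟨s, hs⟩ := h2 t
    exact ⟨s, by rw [hs, ht]⟩
  obtain ⟨s, rfl⟩ := this
  by_cases hs : s ∈ p
  · refine ⟨1 - s, fun h ↦ ?_, Or.inl (hinj ?_)⟩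
    · exact (Ideal.ne_top_iff_one p).mp ‹p.IsPrime›.ne_top (by simpa using add_mem h hs)
    · simp only [map_mul, map_sub, map_zero, sub_mul, one_mul, hea, sub_self]
  · exact ⟨s, hs, Or.inr (hinj (by rw [map_mul, heb, map_zero]))⟩

/-- A smooth algebra over a field is locally a domain, being locally étale over a polynomial
ring. -/
theorem exists_notMem_mul_eq_zero_of_smooth {K C : Type*} [Field K] [CommRing C] [Algebra K C]
    [Algebra.Smooth K C] (p : Ideal C) [p.IsPrime] (a b : C) (hab : a * b = 0) :
    ∃ s ∉ p, s * a = 0 ∨ s * b = 0 := by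
  obtain ⟨f, hfp, n, _, _, _⟩ :=
    Algebra.IsSmoothAt.exists_isStandardEtale_mvPolynomial (R := K) (p := p)
  have hdisj : Disjoint (Submonoid.powers f : Set C) p :=
    (Ideal.disjoint_powers_iff_notMem_of_isPrime _).mpr hfp
  have : (Ideal.map (algebraMap C (Localization.Away f)) p).IsPrime :=
    IsLocalization.isPrime_of_isPrime_disjoint (.powers f) _ _ ‹_› hdisj
  obtain ⟨s, hs, h⟩ := exists_notMem_mul_eq_zero_of_etale (P := MvPolynomial (Fin n) K)
    (Ideal.map (algebraMap C (Localization.Away f)) p) (algebraMap _ (Localization.Away f) a)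
    (algebraMap _ (Localization.Away f) b) (by rw [← map_mul, hab, map_zero])
  obtain ⟨c, ⟨-, m, rfl⟩, hc⟩ := IsLocalization.exists_mk'_eq (Submonoid.powers f) s
  have hcp : c ∉ p := by
    intro h
    apply hs
    rw [← hc, IsLocalization.mk'_mem_map_algebraMap_iff]
    exact ⟨1, one_mem _, by simpa using h⟩
  have key : ∀ x : C, s * algebraMap _ (Localization.Away f) x = 0 → ∃ t ∉ p, t * x = 0 := by
    intro x hx
    have hx' : algebraMap C (Localization.Away f) (c * x) = 0 := by
      have hc' : s * algebraMap C (Localization.Away f) (f ^ m) =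
          algebraMap C (Localization.Away f) c := by
        rw [← hc]
        exact IsLocalization.mk'_spec _ _ _
      rw [map_mul, ← hc', mul_right_comm, hx, zero_mul]
    obtain ⟨⟨-, k, rfl⟩, hk⟩ := (IsLocalization.map_eq_zero_iff (Submonoid.powers f) _ _).mp hx'
    refine ⟨f ^ k * c, ?_, by rw [mul_assoc]; exact hk⟩
    exact fun h ↦ (‹p.IsPrime›.mem_or_mem h).elim
      (fun h ↦ hfp (‹p.IsPrime›.mem_of_pow_mem _ h)) hcp
  rcases h with h | h
  · obtain ⟨t, ht, h⟩ := key a h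
    exact ⟨t, ht, Or.inl h⟩
  · obtain ⟨t, ht, h⟩ := key b h
    exact ⟨t, ht, Or.inr h⟩

theorem eq_zero_or_eq_one_of_isIdempotentElem {C : Type*} [CommRing C]
    [PreconnectedSpace (PrimeSpectrum C)] {e : C} (he : IsIdempotentElem e) : e = 0 ∨ e = 1 := by
  have h := isClopen_iff.mp (PrimeSpectrum.isClopen_iff.mpr ⟨e, he, rfl⟩)
  rcases h with h | h
  · left
    have : IsNilpotent e := (PrimeSpectrum.basicOpen_eq_bot_iff e).mp (by ext1; exact h)
    obtain ⟨n, hn⟩ := this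
    rcases n.eq_zero_or_pos with rfl | hn'
    · have := subsingleton_of_zero_eq_one (by simpa using hn.symm : (0 : C) = 1)
      exact Subsingleton.elim _ _
    · rw [← he.pow_eq hn'.ne', hn]
  · right
    have hu : IsUnit e := by
      by_contra hne
      obtain ⟨m, hm, hem⟩ := exists_max_ideal_of_mem_nonunits hne
      exact (h.ge (Set.mem_univ (⟨m, hm.isPrime⟩ : PrimeSpectrum C))) hem
    exact (IsIdempotentElem.iff_eq_one_of_isUnit hu).mp he

/-- A connected smooth algebra over a field is a domain: if `a b = 0`, then the annihilator `I` of
`a` and the annihilator of `I` are comaximal, since the ring is locally a domain, and the idempotent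
that they define has to be trivial. -/
theorem isDomain_of_smooth_of_connectedSpace {K C : Type*} [Field K] [CommRing C] [Algebra K C]
    [Algebra.Smooth K C] [ConnectedSpace (PrimeSpectrum C)] : IsDomain C := by
  classical
  have : IsNoetherianRing C := Algebra.FiniteType.isNoetherianRing K C
  have : Nontrivial C := PrimeSpectrum.nonempty_iff_nontrivial.mp inferInstance
  have : NoZeroDivisors C := by
    refine ⟨fun {a b} hab ↦ ?_⟩
    let I : Ideal C := Ideal.span {a} |>.annihilator
    have hI : ∀ x, x ∈ I ↔ x * a = 0 := fun x ↦ by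
      simp [I]
    let J : Ideal C := I.annihilator
    have hcop : I ⊔ J = ⊤ := by
      by_contra hne
      obtain ⟨m, hm, hle⟩ := Ideal.exists_le_maximal _ hne
      have hIm : ∀ t ∉ m, t * a ≠ 0 := fun t ht h ↦
        ht (hle (Ideal.mem_sup_left ((hI t).mpr h)))
      obtain ⟨S, hS⟩ := (isNoetherianRing_iff_ideal_fg C).mp inferInstance I
      have hx : ∀ x ∈ I, ∃ t ∉ m, t * x = 0 := by
        intro x hx
        obtain ⟨t, ht, h⟩ := exists_notMem_mul_eq_zero_of_smooth (K := K) m x a ((hI x).mp hx)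
        exact h.elim (fun h ↦ ⟨t, ht, h⟩) (fun h ↦ (hIm t ht h).elim)
      have hx' : ∀ x : C, ∃ t ∉ m, x ∈ I → t * x = 0 := by
        intro x
        by_cases h : x ∈ I
        · obtain ⟨t, ht, h⟩ := hx x h
          exact ⟨t, ht, fun _ ↦ h⟩
        · exact ⟨1, fun h1 ↦ hm.ne_top ((Ideal.eq_top_iff_one m).mpr h1), fun h' ↦ (h h').elim⟩
      choose t ht htx using hx'
      have hprod : ∏ x ∈ S, t x ∈ J := by
        change _ ∈ I.annihilator
        rw [← hS, Submodule.mem_annihilator_span]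
        rintro ⟨x, hxS⟩
        rw [smul_eq_mul, ← Finset.prod_erase_mul S t hxS, mul_assoc,
          htx x (hS ▸ Ideal.subset_span hxS), mul_zero]
      obtain ⟨x, -, hx⟩ := (hm.isPrime.prod_mem_iff).mp (hle (Ideal.mem_sup_right hprod))
      exact ht x hx
    obtain ⟨e, he, f, hf, hef⟩ := Submodule.mem_sup.mp ((Ideal.eq_top_iff_one _).mp hcop)
    have hfe : f * e = 0 := Submodule.mem_annihilator.mp hf e he
    have hidem : IsIdempotentElem e := by
      change e * e = e
      linear_combination e * hef - hfe
    rcases eq_zero_or_eq_one_of_isIdempotentElem hidem with rfl | rfl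
    · right
      have hb : b ∈ I := (hI b).mpr (by rw [mul_comm, hab])
      have := Submodule.mem_annihilator.mp hf b hb
      rwa [show f = 1 by simpa using hef, one_smul] at this
    · left
      simpa using (hI 1).mp he
  exact NoZeroDivisors.to_isDomain C

/-! ### Vanishing differentials, extension of derivations, and descent -/

/-- In characteristic zero, an element with zero differential is algebraic: a transcendental element
belongs to a transcendence basis `t`, and `K` is formally étale over the polynomial ring in `t`, so
that the differentials of the elements of `t` form a basis of `Ω[K⁄κ]`. -/
theorem isAlgebraic_of_D_eq_zero {κ K : Type*} [Field κ] [CharZero κ] [Field K] [Algebra κ K]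
    (s : K) (hs : KaehlerDifferential.D κ K s = 0) : IsAlgebraic κ s := by
  by_contra htr
  obtain ⟨t, hst, ht⟩ := exists_isTranscendenceBasis_superset (R := κ) (s := {s})
    ((algebraicIndependent_singleton_iff (⟨s, rfl⟩ : ({s} : Set K))).mpr htr)
  let P := MvPolynomial t κ
  let _ : Algebra P K := (MvPolynomial.aeval (R := κ) ((↑) : t → K)).toAlgebra
  have : IsScalarTower κ P K := .of_algebraMap_eq fun c ↦ (AlgHom.commutes _ c).symm
  have hinj : Function.Injective (algebraMap P K) := ht.1
  have : FaithfulSMul P K := (faithfulSMul_iff_algebraMap_injective P K).mpr hinj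
  let E := FractionRing P
  let _ : Algebra E K := FractionRing.liftAlgebra P K
  have : IsScalarTower P E K := FractionRing.isScalarTower_liftAlgebra P K
  have : CharZero P := charZero_of_injective_algebraMap (R := κ) (MvPolynomial.C_injective _ _)
  have : CharZero E := charZero_of_injective_algebraMap (R := P) (IsFractionRing.injective P E)
  have : Algebra.IsAlgebraic P K := by
    refine ht.isAlgebraic_iff.mpr fun i ↦ ?_
    rw [← MvPolynomial.aeval_X (R := κ) ((↑) : t → K) i]
    exact isAlgebraic_algebraMap (R := P) (A := K) (MvPolynomial.X i)
  have : Algebra.IsAlgebraic E K := (IsFractionRing.comap_isAlgebraic_iff (A := P)).mp this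
  have : Algebra.FormallyEtale E K := Algebra.FormallyEtale.of_isSeparable E K
  have : Algebra.FormallyEtale P E := Algebra.FormallyEtale.of_isLocalization (nonZeroDivisors P)
  have : Algebra.FormallyEtale P K := Algebra.FormallyEtale.comp P E K
  let e := KaehlerDifferential.tensorKaehlerEquivOfFormallyEtale κ P K
  have h0 : e.symm (KaehlerDifferential.D κ K s) = 0 := by rw [hs, map_zero]
  have hX : algebraMap P K (MvPolynomial.X ⟨s, hst rfl⟩) = s := MvPolynomial.aeval_X _ _
  rw [← hX, KaehlerDifferential.tensorKaehlerEquivOfFormallyEtale_symm_D_algebraMap] at h0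
  have hb := ((KaehlerDifferential.mvPolynomialBasis κ t).baseChange K).ne_zero ⟨s, hst rfl⟩
  apply hb
  rw [Module.Basis.baseChange_apply, KaehlerDifferential.mvPolynomialBasis_apply]
  exact h0

/-- Let `A` be a domain over `B` such that `A ⊗ Ω` is a domain for an algebraically closed
extension `Ω` of `κ = Frac B`. Then `κ` is algebraically closed in `Frac A`: if `s = a / h` is
algebraic, it equals some `α : Ω` in `Frac (A ⊗ Ω)`, and a `κ`-linear retraction `Ω → κ` applied to
`h ⊗ α = a ⊗ 1` exhibits `s` as an element of `κ`. -/
theorem mem_range_algebraMap_of_isAlgebraic {B A κ K Ω : Type*} [CommRing B] [CommRing A]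
    [IsDomain A] [Field κ] [Field K] [Field Ω] [Algebra B A] [Algebra B κ] [Algebra B K]
    [Algebra A K] [Algebra κ K] [Algebra κ Ω] [Algebra B Ω] [IsScalarTower B A K]
    [IsScalarTower B κ K] [IsScalarTower B κ Ω] [IsFractionRing A K] [IsFractionRing B κ]
    [IsAlgClosed Ω] [IsDomain (A ⊗[B] Ω)] (s : K) (hs : IsAlgebraic κ s) :
    s ∈ Set.range (algebraMap κ K) := by
  -- Functionals on `Ω` over `κ` induce maps `A ⊗ Ω → K`.
  let Λ (ℓ : Ω →ₗ[κ] κ) : A ⊗[B] Ω →ₗ[B] K :=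
    TensorProduct.lift (LinearMap.mk₂ B (fun a w ↦ algebraMap A K a * algebraMap κ K (ℓ w))
      (by intros; simp [add_mul]) (by
        intro c m n
        rw [Algebra.smul_def, map_mul, ← IsScalarTower.algebraMap_apply, mul_assoc,
          Algebra.smul_def])
      (by intros; simp [mul_add]) (by
        intro c m n
        rw [← algebraMap_smul κ c n, map_smul, smul_eq_mul, map_mul,
          ← IsScalarTower.algebraMap_apply, Algebra.smul_def]
        ring))
  have hΛ (ℓ : Ω →ₗ[κ] κ) (a : A) (w : Ω) :
      Λ ℓ (a ⊗ₜ w) = algebraMap A K a * algebraMap κ K (ℓ w) := rfl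
  obtain ⟨ℓ₁, hℓ₁⟩ : ∃ ℓ : Ω →ₗ[κ] κ, ℓ 1 = 1 := by
    obtain ⟨ℓ, h⟩ := Module.Projective.exists_dual_ne_zero κ (one_ne_zero : (1 : Ω) ≠ 0)
    exact ⟨(ℓ 1)⁻¹ • ℓ, by simp [h]⟩
  let T := A ⊗[B] Ω
  let Q := FractionRing T
  have hAT : Function.Injective (algebraMap A T) := by
    rw [injective_iff_map_eq_zero]
    intro a ha
    have h := congrArg (Λ ℓ₁) ha
    rw [Algebra.TensorProduct.algebraMap_apply, hΛ, hℓ₁, map_one, mul_one, map_zero] at h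
    exact (map_eq_zero_iff _ (IsFractionRing.injective A K)).mp h
  let g : A →+* Q := (algebraMap T Q).comp (algebraMap A T)
  have hg : Function.Injective g := (IsFractionRing.injective T Q).comp hAT
  let G : K →+* Q := IsFractionRing.lift (A := A) hg
  let ι : Ω →+* Q := (algebraMap T Q).comp
    (Algebra.TensorProduct.includeRight (R := B) (A := A) (B := Ω)).toRingHom
  have hcompat : G.comp (algebraMap κ K) = ι.comp (algebraMap κ Ω) := by
    refine IsLocalization.ringHom_ext (nonZeroDivisors B) (RingHom.ext fun b ↦ ?_)
    simp only [RingHom.comp_apply]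
    rw [← IsScalarTower.algebraMap_apply B κ K, IsScalarTower.algebraMap_apply B A K,
      ← IsScalarTower.algebraMap_apply B κ Ω]
    change IsFractionRing.lift hg _ = _
    rw [IsFractionRing.lift_algebraMap]
    refine congrArg (algebraMap T Q) ?_
    change algebraMap B A b ⊗ₜ[B] (1 : Ω) = (1 : A) ⊗ₜ[B] algebraMap B Ω b
    rw [Algebra.algebraMap_eq_smul_one, Algebra.algebraMap_eq_smul_one, TensorProduct.smul_tmul]
  obtain ⟨α, hα⟩ : ∃ α : Ω, ι α = G s := by
    obtain ⟨f, hf0, hf⟩ := hs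
    refine (IsAlgClosed.splits (f.map (algebraMap κ Ω))).mem_range_of_isRoot
      (Polynomial.map_ne_zero hf0) ?_
    rw [Polynomial.map_map, ← hcompat, ← Polynomial.map_map, Polynomial.IsRoot, Polynomial.eval_map,
      Polynomial.eval₂_at_apply, Polynomial.eval_map_algebraMap, hf, map_zero]
  obtain ⟨a, h, hh, rfl⟩ := IsFractionRing.div_surjective (A := A) s
  have hh0 : algebraMap A K h ≠ 0 := by
    simpa using (map_ne_zero_iff _ (IsFractionRing.injective A K)).mpr (nonZeroDivisors.ne_zero hh)
  have hT : h ⊗ₜ[B] α = a ⊗ₜ[B] (1 : Ω) := by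
    apply IsFractionRing.injective T Q
    have h1 : G (algebraMap A K h) * ι α = G (algebraMap A K a) := by
      rw [hα, ← map_mul, mul_div_cancel₀ _ hh0]
    have hG (x : A) : G (algebraMap A K x) = g x := IsFractionRing.lift_algebraMap hg x
    rw [hG, hG] at h1
    have h2 : h ⊗ₜ[B] α = algebraMap A T h * (1 : A) ⊗ₜ[B] α := by
      rw [Algebra.TensorProduct.algebraMap_apply, Algebra.TensorProduct.tmul_mul_tmul, mul_one,
        one_mul]
      rfl
    rw [h2, map_mul]
    exact h1
  have h3 := congrArg (Λ ℓ₁) hT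
  rw [hΛ, hΛ, hℓ₁, map_one, mul_one] at h3
  exact ⟨ℓ₁ α, by rw [← h3, mul_div_cancel_left₀ _ hh0]⟩

/-- A surjection `W → C` of smooth algebras, with source a noetherian domain, is injective if
derivations extend along it: then `C ⊗ Ω[W⁄L] → Ω[C⁄L]` is injective, so that the conormal module
`I / I²` of the kernel vanishes, and a proper idempotent ideal of `W` is zero. -/
theorem injective_of_formallySmooth_of_derivation {L W C : Type u} [CommRing L] [CommRing W]
    [CommRing C] [Algebra L W] [Algebra W C] [Algebra L C] [IsScalarTower L W C]
    [Algebra.FormallySmooth L W] [Algebra.FormallySmooth L C] [IsDomain W] [IsNoetherianRing W]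
    [Nontrivial C] (hsurj : Function.Surjective (algebraMap W C))
    (hext : ∀ (M : Type u) [AddCommGroup M] [Module L M] [Module W M] [Module C M]
      [IsScalarTower W C M] [IsScalarTower L C M] [IsScalarTower L W M] (δ : Derivation L W M),
      ∃ D : Derivation L C M, ∀ w, D (algebraMap W C w) = δ w) :
    Function.Injective (algebraMap W C) := by
  let M := C ⊗[W] Ω[W⁄L]
  let δ : Derivation L W M :=
    (TensorProduct.mk W C Ω[W⁄L] 1).compDer (KaehlerDifferential.D L W)
  obtain ⟨D, hD⟩ := hext M δ
  have hinj : Function.Injective (KaehlerDifferential.mapBaseChange L W C) := by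
    have : D.liftKaehlerDifferential ∘ₗ KaehlerDifferential.mapBaseChange L W C =
        LinearMap.id := by
      ext x
      simp [KaehlerDifferential.mapBaseChange_tmul, hD, δ]
    exact Function.HasLeftInverse.injective
      ⟨D.liftKaehlerDifferential, fun x ↦ LinearMap.congr_fun this x⟩
  have hker : Function.Injective (KaehlerDifferential.kerCotangentToTensor L W C) :=
    (Algebra.FormallySmooth.kerCotangentToTensor_injective_iff hsurj).mpr inferInstance
  have hsq : IsIdempotentElem (RingHom.ker (algebraMap W C)) := by
    rw [← Ideal.cotangent_subsingleton_iff]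
    refine ⟨fun x y ↦ hker (hinj ?_)⟩
    have hex := KaehlerDifferential.exact_kerCotangentToTensor_mapBaseChange L W C hsurj
    rw [(hex _).mpr ⟨x, rfl⟩, (hex _).mpr ⟨y, rfl⟩]
  rcases (Ideal.isIdempotentElem_iff_eq_bot_or_top _
    ((isNoetherianRing_iff_ideal_fg W).mp inferInstance _)).mp hsq with h | h
  · exact (RingHom.injective_iff_ker_eq_bot _).mpr h
  · exact absurd h (RingHom.ker_ne_top _)

/-- A quotient `b / b'` of elements of `R` which lies in a faithfully flat local extension `S` lies
in `R`, because `b' S ∩ R = b' R`. -/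
theorem exists_algebraMap_eq_of_mul_eq {R S : Type*} [CommRing R] [CommRing S] [IsDomain S]
    [Algebra R S] [IsLocalRing R] [IsLocalRing S] [IsLocalHom (algebraMap R S)] [Module.Flat R S]
    (b b' : R) (hb' : b' ≠ 0) (s : S) (h : algebraMap R S b = algebraMap R S b' * s) :
    ∃ r, algebraMap R S r = s := by
  have : Module.FaithfullyFlat R S := Module.FaithfullyFlat.of_flat_of_isLocalHom
  have hmem : b ∈ ((Ideal.span {b'}).map (algebraMap R S)).comap (algebraMap R S) := by
    rw [Ideal.mem_comap, h, Ideal.map_span, Set.image_singleton]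
    exact Ideal.mul_mem_right _ _ (Ideal.mem_span_singleton_self _)
  rw [Ideal.comap_map_eq_self_of_faithfullyFlat] at hmem
  obtain ⟨r, rfl⟩ := Ideal.mem_span_singleton'.mp hmem
  have hinj : Function.Injective (algebraMap R S) := FaithfulSMul.algebraMap_injective R S
  refine ⟨r, mul_left_cancel₀ ((map_ne_zero_iff _ hinj).mpr hb') ?_⟩
  rw [← h, map_mul, mul_comm]

namespace Foliation

/-! ### Quotients of the cotangent sheaf -/

section EpiSheafification

open PresheafOfModules

/-- Let `q : P^# ⟶ M` be an epimorphism of sheaves of modules. Then sections of `M` locally come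
from sections of the presheaf `P`. -/
theorem exists_res_mem_range_of_epi_sheafification {T : TopCat.{u}}
    (R : Sheaf (Opens.grothendieckTopology T) RingCat.{u}) (P : PresheafOfModules.{u} R.obj)
    (M : SheafOfModules.{u} R) (q : (sheafification (𝟙 R.obj)).obj P ⟶ M) [Epi q]
    (U : Opens T) (s : M.val.obj (op U)) (x : T) (hx : x ∈ U) :
    ∃ (V : Opens T) (i : V ⟶ U) (t : P.obj (op V)), x ∈ V ∧
      (sheafificationHomEquiv (𝟙 R.obj) q).app (op V) t = M.val.map i.op s := by
  let h : P ⟶ M.val := sheafificationHomEquiv (𝟙 R.obj) q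
  let c := cokernel.π h
  let η : cokernel h ⟶ ((sheafification (𝟙 R.obj)).obj (cokernel h)).val :=
    sheafificationHomEquiv (𝟙 R.obj) (𝟙 _)
  let m : M ⟶ (sheafification (𝟙 R.obj)).obj (cokernel h) := ⟨c ≫ η⟩
  -- The map from `M` to the sheafified cokernel of `P ⟶ M` vanishes, as `q` is an epimorphism.
  have hm : q ≫ m = 0 := by
    apply (sheafificationHomEquiv (𝟙 R.obj)).injective
    apply (PresheafOfModules.toPresheaf _).map_injective
    change (PresheafOfModules.toPresheaf _).map (h ≫ c ≫ η) = _
    rw [cokernel.condition_assoc, zero_comp]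
    rfl
  have hm0 : m = 0 := by rw [← cancel_epi q, hm, comp_zero]
  have hcη : c ≫ η = 0 := congrArg SheafOfModules.Hom.val hm0
  have hη : (toPresheaf _).map η = CategoryTheory.toSheafify _ (cokernel h).presheaf := by
    refine (toPresheaf_map_sheafificationHomEquiv_def (𝟙 R.obj) _).trans ?_
    exact Category.comp_id _
  have hzero : (CategoryTheory.toSheafify (Opens.grothendieckTopology T)
      (cokernel h).presheaf).app (op U) (c.app (op U) s) =
      (CategoryTheory.toSheafify (Opens.grothendieckTopology T)
        (cokernel h).presheaf).app (op U) 0 := by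
    rw [map_zero, ← hη]
    exact congr($(hcη).app (op U) s)
  obtain ⟨V, i, hi, hxV⟩ :=
    Presheaf.equalizerSieve_mem (Opens.grothendieckTopology T) _ _ _ hzero x hx
  -- Hence `s` vanishes in the presheaf cokernel after restriction to some `V`.
  refine ⟨V, i, ?_⟩
  have hc0 : c.app (op V) (M.val.map i.op s) = 0 := by
    rw [PresheafOfModules.naturality_apply]
    refine Eq.trans hi ?_
    exact map_zero _
  let S : ShortComplex (PresheafOfModules.{u} R.obj) := ShortComplex.mk h c (cokernel.condition h)
  have hS : S.Exact := ShortComplex.exact_cokernel h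
  have hS' : (S.map (evaluation R.obj (op V))).Exact := hS.map _
  obtain ⟨t, ht⟩ := (ShortComplex.moduleCat_exact_iff _).mp hS' _ hc0
  exact ⟨t, hxV, ht⟩

end EpiSheafification

section Diff

variable {k : Type u} [CommRing k] {X : Scheme.{u}} {p : X ⟶ Spec (CommRingCat.of k)}
  {M N : X.Modules}

theorem diff_comp (q : cotangentSheaf p ⟶ M) (f : M ⟶ N) (U : X.Opens) (a : Γ(X, U)) :
    diff (q ≫ f) U a = f.app U (diff q U a) :=
  rfl

theorem cotangentSheaf_hom_ext {q q' : cotangentSheaf p ⟶ M}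
    (h : ∀ (U : X.Opens) (a : Γ(X, U)), diff q U a = diff q' U a) : q = q' := by
  rw [← cotangentDesc_derivationOf q, ← cotangentDesc_derivationOf q']
  congr 1
  ext U a
  exact h U.unop a

theorem app_res (f : M ⟶ N) {U V : X.Opens} (i : V ⟶ U) (s : Γ(M, U)) :
    f.app V (M.presheaf.map i.op s) = N.presheaf.map i.op (f.app U s) :=
  congr($(f.mapPresheaf.naturality i.op) s)

/-- The linear map `Ω_{Γ(X, V)/k} → Γ(V, M)` induced by the derivation `q ∘ d`. -/
theorem exists_kaehlerDifferential_map (q : cotangentSheaf p ⟶ M) (V : X.Opens) :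
    letI := (scalarMap p V).hom.toAlgebra
    ∃ g : Ω[Γ(X, V)⁄k] →ₗ[Γ(X, V)] Γ(M, V),
      (∀ a, g (KaehlerDifferential.D k Γ(X, V) a) = diff q V a) ∧
      LinearMap.range g = Submodule.span Γ(X, V) (Set.range (diff q V)) := by
  let _ := (scalarMap p V).hom.toAlgebra
  let g : Ω[Γ(X, V)⁄k] →ₗ[Γ(X, V)] Γ(M, V) :=
    ((PresheafOfModules.sheafificationHomEquiv (𝟙 X.ringCatSheaf.obj) q).app (op V)).hom
  have hg (a : Γ(X, V)) : g (KaehlerDifferential.D k Γ(X, V) a) = diff q V a := rfl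
  refine ⟨g, hg, ?_⟩
  rw [LinearMap.range_eq_map, ← KaehlerDifferential.span_range_derivation, Submodule.map_span,
    ← Set.range_comp]
  rfl

/-- If `q : Ω¹ ⟶ M` is an epimorphism, then `M` is locally generated by the sections `q (d a)`. -/
theorem exists_res_mem_span_diff (q : cotangentSheaf p ⟶ M) [Epi q] (U : X.Opens) (s : Γ(M, U))
    (x : X) (hx : x ∈ U) : ∃ (V : X.Opens) (i : V ⟶ U), x ∈ V ∧
      M.presheaf.map i.op s ∈ Submodule.span Γ(X, V) (Set.range (diff q V)) := by
  obtain ⟨V, i, t, hxV, ht⟩ := @exists_res_mem_range_of_epi_sheafification X.carrier X.ringCatSheaf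
    (PresheafOfModules.DifferentialsConstruction.relativeDifferentials' (scalarPresheafMap p))
    M q ‹Epi q› U s x hx
  refine ⟨V, i, hxV, ?_⟩
  change M.val.map i.op s ∈ _
  rw [← ht]
  let _ := (scalarMap p V).hom.toAlgebra
  let g : Ω[Γ(X, V)⁄k] →ₗ[Γ(X, V)] Γ(M, V) :=
    ((PresheafOfModules.sheafificationHomEquiv (𝟙 X.ringCatSheaf.obj) q).app (op V)).hom
  have hg (a : Γ(X, V)) : g (KaehlerDifferential.D k Γ(X, V) a) = diff q V a := rfl
  change g t ∈ _
  have ht' : (t : Ω[Γ(X, V)⁄k]) ∈ Submodule.span Γ(X, V)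
      (Set.range (KaehlerDifferential.D k Γ(X, V))) := by
    rw [KaehlerDifferential.span_range_derivation]; trivial
  have := Submodule.mem_map_of_mem (f := g) ht'
  rw [Submodule.map_span, ← Set.range_comp] at this
  exact this

/-- A morphism out of a quotient of `Ω¹` is determined by its values on the sections `q (d a)`. -/
theorem hom_ext_of_epi (q : cotangentSheaf p ⟶ M) [Epi q] {f g : M ⟶ N}
    (h : ∀ (U : X.Opens) (a : Γ(X, U)), f.app U (diff q U a) = g.app U (diff q U a)) : f = g := by
  rw [← cancel_epi q]
  exact cotangentSheaf_hom_ext h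

end Diff

/-! ### Derivations on affine schemes -/

section AffineDerivation

/-- Maps satisfying the Leibniz rule on a localization are determined by their values on the
original ring. -/
theorem addMonoidHom_eq_of_leibniz {C A S N : Type*} [CommRing C] [CommRing A] [CommRing S]
    [AddCommGroup N] [Module S N] (i : C →+* A) (ρ : A →+* S)
    (hloc : ∀ a, ∃ s c, IsUnit (ρ (i s)) ∧ i s * a = i c) (φ ψ : A →+ N)
    (hφ : ∀ a b, φ (a * b) = ρ a • φ b + ρ b • φ a)
    (hψ : ∀ a b, ψ (a * b) = ρ a • ψ b + ρ b • ψ a) (h : ∀ c, φ (i c) = ψ (i c)) : φ = ψ := by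
  ext a
  obtain ⟨s, c, hs, hc⟩ := hloc a
  have h1 := hφ (i s) a
  rw [hc, h, ← hc, hψ, h s] at h1
  exact ((hs.smul_left_cancel).mp (add_right_cancel h1)).symm

/-- A derivation extends to a formally étale algebra. -/
theorem exists_derivation_of_formallyEtale {R A A' N : Type*} [CommRing R] [CommRing A]
    [CommRing A'] [AddCommGroup N] [Algebra R A] [Algebra R A'] [Algebra A A']
    [IsScalarTower R A A'] [Algebra.FormallyEtale A A'] [Module R N] [Module A N] [Module A' N]
    [IsScalarTower R A N] [IsScalarTower R A' N] [IsScalarTower A A' N] (D : Derivation R A N) :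
    ∃ D' : Derivation R A' N, ∀ a, D' (algebraMap A A' a) = D a := by
  refine ⟨((KaehlerDifferential.isBaseChange_of_formallyEtale R A A').lift
    D.liftKaehlerDifferential).compDer (KaehlerDifferential.D R A'), fun a ↦ ?_⟩
  have := (KaehlerDifferential.isBaseChange_of_formallyEtale R A A').lift_eq
    D.liftKaehlerDifferential (KaehlerDifferential.D R A a)
  rw [KaehlerDifferential.map_D, D.liftKaehlerDifferential_comp_D] at this
  exact this

variable {R : Type u} [CommRing R] {Y : Scheme.{u}} [IsAffine Y]
  {r : Y ⟶ Spec (CommRingCat.of R)} {N : Y.Modules}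

theorem exists_res_mul_eq_of_isAffine (f : Γ(Y, ⊤)) (a : Γ(Y, Y.basicOpen f)) :
    ∃ s c : Γ(Y, ⊤), IsUnit (Y.presheaf.map (Y.basicOpen f).leTop.op s) ∧
      Y.presheaf.map (Y.basicOpen f).leTop.op s * a =
        Y.presheaf.map (Y.basicOpen f).leTop.op c := by
  have := (isAffineOpen_top Y).isLocalization_basicOpen f
  obtain ⟨⟨c, s⟩, h⟩ := IsLocalization.surj (Submonoid.powers f) a
  exact ⟨s, c, IsLocalization.map_units Γ(Y, Y.basicOpen f) s, (mul_comm _ _).trans h⟩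

theorem section_ext_of_isAffine {U : Y.Opens} {s t : Γ(N, U)}
    (h : ∀ (f : Γ(Y, ⊤)) (i : Y.basicOpen f ⟶ U), N.presheaf.map i.op s = N.presheaf.map i.op t) :
    s = t := by
  refine TopCat.Presheaf.IsSheaf.section_ext N.isSheaf fun x hx ↦ ?_
  obtain ⟨_, ⟨_, ⟨f, rfl⟩, rfl⟩, hxf, hfU⟩ :=
    (isBasis_basicOpen Y).exists_subset_of_mem_open hx U.isOpen
  exact ⟨Y.basicOpen f, hfU, hxf, h f (homOfLE hfU)⟩

/-- Two derivations on an affine scheme which agree on global functions agree. -/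
theorem diff_eq_diff_of_isAffine {S : Type u} [CommRing S] {r' : Y ⟶ Spec (CommRingCat.of S)}
    {q : cotangentSheaf r ⟶ N} {q' : cotangentSheaf r' ⟶ N}
    (h : ∀ a : Γ(Y, ⊤), diff q ⊤ a = diff q' ⊤ a) (U : Y.Opens) (a : Γ(Y, U)) :
    diff q U a = diff q' U a := by
  have hb (f : Γ(Y, ⊤)) : diff q (Y.basicOpen f) = diff q' (Y.basicOpen f) := by
    refine addMonoidHom_eq_of_leibniz (Y.presheaf.map (Y.basicOpen f).leTop.op).hom (RingHom.id _)
      (exists_res_mul_eq_of_isAffine f) _ _ (diff_mul q _) (diff_mul q' _) fun c ↦ ?_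
    refine (diff_res q _ c).trans (Eq.trans ?_ (diff_res q' _ c).symm)
    rw [h]
  refine section_ext_of_isAffine fun f i ↦ ?_
  rw [← diff_res, ← diff_res, hb]

theorem cotangentSheaf_hom_ext_of_isAffine {q q' : cotangentSheaf r ⟶ N}
    (h : ∀ a : Γ(Y, ⊤), diff q ⊤ a = diff q' ⊤ a) : q = q' :=
  cotangentSheaf_hom_ext (diff_eq_diff_of_isAffine h)

/-- A derivation on the global functions of an affine scheme extends to the functions on a basic
open subset, these being a localization. -/
theorem exists_leibniz_basicOpen (D : Γ(Y, ⊤) →+ Γ(N, ⊤))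
    (hmul : ∀ a b, D (a * b) = a • D b + b • D a) (hscal : ∀ c, D (scalarMap r ⊤ c) = 0)
    (f : Γ(Y, ⊤)) :
    ∃ E : Γ(Y, Y.basicOpen f) →+ Γ(N, Y.basicOpen f), (∀ a b, E (a * b) = a • E b + b • E a) ∧
      ∀ a, E (Y.presheaf.map (Y.basicOpen f).leTop.op a) =
        N.presheaf.map (Y.basicOpen f).leTop.op (D a) := by
  let ρ := (Y.presheaf.map (Y.basicOpen f).leTop.op).hom
  have := (isAffineOpen_top Y).isLocalization_basicOpen f
  let _ : Algebra R Γ(Y, ⊤) := (scalarMap r ⊤).hom.toAlgebra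
  let _ : Algebra R Γ(Y, Y.basicOpen f) := (scalarMap r _).hom.toAlgebra
  have : IsScalarTower R Γ(Y, ⊤) Γ(Y, Y.basicOpen f) :=
    .of_algebraMap_eq fun c ↦ congr($(scalarMap_res r (Y.basicOpen f).leTop) c).symm
  have : Algebra.FormallyEtale Γ(Y, ⊤) Γ(Y, Y.basicOpen f) :=
    .of_isLocalization (Submonoid.powers f)
  let _ : Module Γ(Y, ⊤) Γ(N, Y.basicOpen f) := Module.compHom _ ρ
  let _ : Module R Γ(N, Y.basicOpen f) := Module.compHom _ (scalarMap r (Y.basicOpen f)).hom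
  have : IsScalarTower Γ(Y, ⊤) Γ(Y, Y.basicOpen f) Γ(N, Y.basicOpen f) := .of_compHom _ _ _
  have : IsScalarTower R Γ(Y, Y.basicOpen f) Γ(N, Y.basicOpen f) := .of_compHom _ _ _
  have : IsScalarTower R Γ(Y, ⊤) Γ(N, Y.basicOpen f) := .of_algebraMap_smul fun c x ↦ by
    exact congrArg (fun z : Γ(Y, Y.basicOpen f) ↦ z • x)
      congr($(scalarMap_res r (Y.basicOpen f).leTop) c)
  let δ : Derivation R Γ(Y, ⊤) Γ(N, Y.basicOpen f) :=
    { toFun := fun a ↦ N.presheaf.map (Y.basicOpen f).leTop.op (D a)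
      map_add' := fun a b ↦ by rw [map_add, map_add]
      map_smul' := fun c a ↦ by
        rw [Algebra.smul_def, hmul, RingHom.algebraMap_toAlgebra, hscal, smul_zero, add_zero,
          Scheme.Modules.map_smul]
        exact congrArg (fun z : Γ(Y, Y.basicOpen f) ↦ z • _)
          congr($(scalarMap_res r (Y.basicOpen f).leTop) c)
      map_one_eq_zero' := by
        change N.presheaf.map (Y.basicOpen f).leTop.op (D 1) = 0
        rw [← map_one (scalarMap r ⊤).hom, hscal, map_zero]
      leibniz' := fun a b ↦ by
        change N.presheaf.map (Y.basicOpen f).leTop.op (D (a * b)) = _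
        rw [hmul, map_add, Scheme.Modules.map_smul, Scheme.Modules.map_smul]
        rfl }
  obtain ⟨E, hE⟩ := exists_derivation_of_formallyEtale (A' := Γ(Y, Y.basicOpen f)) δ
  exact ⟨E.toLinearMap.toAddMonoidHom, E.leibniz, hE⟩

/-- On an affine scheme, a derivation from the global functions to the global sections of a sheaf of
modules `N` comes from a map `Ω¹ ⟶ N`. As derivations extend uniquely to localizations, no
quasi-coherence of `N` is needed. -/
theorem exists_diff_top_eq (D : Γ(Y, ⊤) →+ Γ(N, ⊤))
    (hmul : ∀ a b, D (a * b) = a • D b + b • D a) (hscal : ∀ c, D (scalarMap r ⊤ c) = 0) :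
    ∃ q : cotangentSheaf r ⟶ N, ∀ a, diff q ⊤ a = D a := by
  choose E hE hED using exists_leibniz_basicOpen D hmul hscal
  let P : TopCat.Presheaf Ab Y := Y.presheaf ⋙ forget₂ CommRingCat RingCat ⋙ forget₂ RingCat Ab
  have hnat (f g : Γ(Y, ⊤)) (i : Y.basicOpen g ⟶ Y.basicOpen f) (a : Γ(Y, Y.basicOpen f)) :
      E g (Y.presheaf.map i.op a) = N.presheaf.map i.op (E f a) := by
    have hi (c : Γ(Y, ⊤)) : Y.presheaf.map i.op (Y.presheaf.map (Y.basicOpen f).leTop.op c) =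
        Y.presheaf.map (Y.basicOpen g).leTop.op c := by
      rw [← ConcreteCategory.comp_apply, ← Functor.map_comp]; rfl
    have hi' (c : Γ(N, ⊤)) : N.presheaf.map i.op (N.presheaf.map (Y.basicOpen f).leTop.op c) =
        N.presheaf.map (Y.basicOpen g).leTop.op c := by
      rw [← ConcreteCategory.comp_apply, ← Functor.map_comp]; rfl
    refine DFunLike.congr_fun (addMonoidHom_eq_of_leibniz
      (Y.presheaf.map (Y.basicOpen f).leTop.op).hom (Y.presheaf.map i.op).hom (fun b ↦ ?_)
      ((E g).comp (Y.presheaf.map i.op).hom.toAddMonoidHom)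
      ((N.presheaf.map i.op).hom.comp (E f)) ?_ ?_ ?_) a
    · obtain ⟨s, c, hs, hc⟩ := exists_res_mul_eq_of_isAffine f b
      exact ⟨s, c, hs.map _, hc⟩
    · intro b c
      change E g (Y.presheaf.map i.op (b * c)) = _
      rw [map_mul, hE]
      rfl
    · intro b c
      change N.presheaf.map i.op (E f (b * c)) = _
      rw [hE, map_add, Scheme.Modules.map_smul, Scheme.Modules.map_smul]
      rfl
    · intro c
      change E g (Y.presheaf.map i.op (Y.presheaf.map (Y.basicOpen f).leTop.op c)) =
        N.presheaf.map i.op (E f (Y.presheaf.map (Y.basicOpen f).leTop.op c))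
      rw [hi, hED, hED, hi']
  -- The derivations on basic opens glue to a map of sheaves, which inherits the Leibniz rule.
  let α : (inducedFunctor (Y.basicOpen : Γ(Y, ⊤) → Y.Opens)).op ⋙ P ⟶
      (inducedFunctor (Y.basicOpen : Γ(Y, ⊤) → Y.Opens)).op ⋙ N.presheaf :=
    { app := fun f ↦ AddCommGrpCat.ofHom (E f.unop)
      naturality := fun f g i ↦ by
        ext a
        exact hnat _ _ ((inducedFunctor (Y.basicOpen : Γ(Y, ⊤) → Y.Opens)).map i.unop) a }
  let Δ : P ⟶ N.presheaf := TopCat.Sheaf.restrictHomEquivHom P ⟨N.presheaf, N.isSheaf⟩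
    (isBasis_basicOpen Y) α
  have hΔ (f : Γ(Y, ⊤)) (a : Γ(Y, Y.basicOpen f)) : Δ.app (op (Y.basicOpen f)) a = E f a :=
    congr($(TopCat.Sheaf.extend_hom_app P ⟨N.presheaf, N.isSheaf⟩ (isBasis_basicOpen Y) α f) a)
  have hΔres {U V : Y.Opens} (i : V ⟶ U) (a : Γ(Y, U)) :
      Δ.app (op V) (Y.presheaf.map i.op a) = N.presheaf.map i.op (Δ.app (op U) a) :=
    congr($(Δ.naturality i.op) a)
  have hΔmul (U : Y.Opens) (a b : Γ(Y, U)) : (Δ.app (op U) (a * b : Γ(Y, U)) : Γ(N, U)) =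
      a • (Δ.app (op U) b : Γ(N, U)) + b • (Δ.app (op U) a : Γ(N, U)) := by
    refine section_ext_of_isAffine fun f i ↦ ?_
    refine (hΔres i (a * b)).symm.trans ?_
    rw [map_add, Scheme.Modules.map_smul, Scheme.Modules.map_smul]
    refine Eq.trans ?_ (congrArg₂ (fun z w : Γ(N, Y.basicOpen f) ↦
      Y.presheaf.map i.op a • z + Y.presheaf.map i.op b • w) (hΔres i b) (hΔres i a))
    rw [map_mul, hΔ, hΔ, hΔ, hE]
  have hΔscal (U : Y.Opens) (c : R) : (Δ.app (op U) (scalarMap r U c) : Γ(N, U)) = 0 := by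
    refine section_ext_of_isAffine fun f i ↦ ?_
    refine (hΔres i _).symm.trans ?_
    rw [map_zero, hΔ]
    have h1 : Y.presheaf.map i.op (scalarMap r U c) =
        Y.presheaf.map (Y.basicOpen f).leTop.op (scalarMap r ⊤ c) :=
      congr($(scalarMap_res r i) c).trans congr($(scalarMap_res r (Y.basicOpen f).leTop) c).symm
    rw [h1, hED, hscal, map_zero]
  refine ⟨cotangentDesc
    { d := fun {U} ↦ (Δ.app U).hom
      d_mul := fun {U} a b ↦ hΔmul U.unop a b
      d_map := fun {U V} i a ↦ hΔres i.unop a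
      d_app := fun {U} c ↦ hΔscal U.unop c }, fun a ↦ ?_⟩
  rw [diff_cotangentDesc]
  refine section_ext_of_isAffine fun f i ↦ ?_
  refine (hΔres i a).symm.trans ?_
  rw [hΔ]
  exact hED f a

end AffineDerivation

/-! ### Derivations and base change -/

section LeibnizBaseChange

/-- Derivations extend along base change of rings. -/
theorem exists_derivation_of_isPushout {B A L W N : Type*} [CommRing B] [CommRing A] [CommRing L]
    [CommRing W] [AddCommGroup N] [Algebra B A] [Algebra B L] [Algebra A W] [Algebra L W]
    [Algebra B W] [IsScalarTower B A W] [IsScalarTower B L W] [Algebra.IsPushout B L A W]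
    [Module B N] [Module A N] [Module L N] [Module W N] [IsScalarTower B A N]
    [IsScalarTower L W N] [IsScalarTower A W N] (D : Derivation B A N) :
    ∃ D' : Derivation L W N, ∀ a, D' (algebraMap A W a) = D a := by
  refine ⟨((D.liftKaehlerDifferential.liftBaseChange W).comp
    (KaehlerDifferential.tensorKaehlerEquiv B L A W).symm.toLinearMap).compDer
      (KaehlerDifferential.D L W), fun a ↦ ?_⟩
  have h : KaehlerDifferential.D L W (algebraMap A W a) =
      KaehlerDifferential.tensorKaehlerEquiv B L A W (1 ⊗ₜ KaehlerDifferential.D B A a) := by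
    rw [KaehlerDifferential.tensorKaehlerEquiv_tmul_D, one_smul]
  change D.liftKaehlerDifferential.liftBaseChange W
    ((KaehlerDifferential.tensorKaehlerEquiv B L A W).symm
      (KaehlerDifferential.D L W (algebraMap A W a))) = _
  rw [h, LinearEquiv.symm_apply_apply, LinearMap.liftBaseChange_tmul, one_smul,
    D.liftKaehlerDifferential_comp_D]

/-- Maps satisfying the Leibniz rule on a base change `A ⊗[B] L` which vanish on `L` are determined
by their values on `A`. -/
theorem addMonoidHom_eq_of_isPushout {B A L W : CommRingCat.{u}} {N : Type*} [AddCommGroup N]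
    [Module W N] {α : B ⟶ A} {β : B ⟶ L} {τ : A ⟶ W} {σ : L ⟶ W} (H : IsPushout α β τ σ)
    (φ ψ : W →+ N) (hφ : ∀ a b, φ (a * b) = a • φ b + b • φ a)
    (hψ : ∀ a b, ψ (a * b) = a • ψ b + b • ψ a) (hφ0 : ∀ c, φ (σ c) = 0) (hψ0 : ∀ c, ψ (σ c) = 0)
    (h : ∀ a, φ (τ a) = ψ (τ a)) : φ = ψ := by
  ext w
  have hw : w ∈ Subring.closure (Set.range τ ∪ Set.range σ) := by
    rw [CommRingCat.closure_range_union_range_eq_top_of_isPushout H]; trivial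
  induction hw using Subring.closure_induction with
  | mem x hx =>
    obtain ⟨a, rfl⟩ | ⟨c, rfl⟩ := hx
    · exact h a
    · rw [hφ0, hψ0]
  | zero => rw [map_zero, map_zero]
  | one => rw [← map_one σ.hom]; exact (hφ0 1).trans (hψ0 1).symm
  | add x y _ _ hx hy => rw [map_add, map_add, hx, hy]
  | neg x _ hx => rw [map_neg, map_neg, hx]
  | mul x y _ _ hx hy => rw [hφ, hψ, hx, hy]

/-- A derivation `A → N` over `B` extends to the base change `W = A ⊗[B] L` as a derivation over
`L`, for a `W`-module `N`. -/
theorem exists_leibniz_of_isPushout {B A L W : CommRingCat.{u}} {N : Type*} [AddCommGroup N]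
    [Module W N] {α : B ⟶ A} {β : B ⟶ L} {τ : A ⟶ W} {σ : L ⟶ W} (H : IsPushout α β τ σ)
    (δ : A →+ N) (hδ : ∀ a b, δ (a * b) = τ a • δ b + τ b • δ a) (hδ0 : ∀ b, δ (α b) = 0) :
    ∃ D : W →+ N, (∀ a b, D (a * b) = a • D b + b • D a) ∧ (∀ c, D (σ c) = 0) ∧
      ∀ a, D (τ a) = δ a := by
  algebraize [α.hom, β.hom, τ.hom, σ.hom, τ.hom.comp α.hom]
  have : IsScalarTower B L W := .of_algebraMap_eq fun b ↦ congr($(H.w) b)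
  have : Algebra.IsPushout B L A W := (CommRingCat.isPushout_iff_isPushout.mp H).symm
  let _ : Module A N := Module.compHom _ τ.hom
  let _ : Module L N := Module.compHom _ σ.hom
  let _ : Module B N := Module.compHom _ (τ.hom.comp α.hom)
  have : IsScalarTower A W N := .of_compHom _ _ _
  have : IsScalarTower L W N := .of_compHom _ _ _
  have : IsScalarTower B A N := .of_algebraMap_smul fun _ _ ↦ rfl
  let δ' : Derivation B A N :=
    { toFun := δ
      map_add' := map_add δ
      map_smul' := fun b a ↦ by
        rw [Algebra.smul_def, hδ, RingHom.algebraMap_toAlgebra, hδ0, smul_zero, add_zero]; rfl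
      map_one_eq_zero' := by
        change δ 1 = 0
        rw [← map_one α.hom]; exact hδ0 1
      leibniz' := hδ }
  obtain ⟨D, hD⟩ := exists_derivation_of_isPushout (L := L) (W := W) δ'
  exact ⟨D.toLinearMap.toAddMonoidHom, D.leibniz, D.map_algebraMap, hD⟩

theorem scalarMap_top {S : Type u} [CommRing S] {T : Scheme.{u}}
    (s : T ⟶ Spec (CommRingCat.of S)) :
    scalarMap s ⊤ = (Scheme.ΓSpecIso (CommRingCat.of S)).inv ≫ s.appTop := by
  rw [scalarMap]
  have : T.presheaf.map (homOfLE (le_top : (⊤ : T.Opens) ≤ ⊤)).op = 𝟙 _ :=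
    T.presheaf.map_id _
  rw [this, Category.comp_id]

/-- The coordinate ring of the base change of an affine scheme `Y ⟶ Spec B` along
`Spec L ⟶ Spec B`. -/
theorem isPushout_scalarMap {B L : Type u} [CommRing B] [CommRing L] {Y Z : Scheme.{u}}
    [IsAffine Y] {π : Y ⟶ Spec (CommRingCat.of B)} {f : Z ⟶ Y} {r : Z ⟶ Spec (CommRingCat.of L)}
    {y : Spec (CommRingCat.of L) ⟶ Spec (CommRingCat.of B)} (h : IsPullback f r π y) :
    IsPushout (scalarMap π ⊤) ((Scheme.ΓSpecIso (CommRingCat.of B)).inv ≫ y.appTop ≫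
      (Scheme.ΓSpecIso (CommRingCat.of L)).hom) f.appTop (scalarMap r ⊤) := by
  rw [scalarMap_top, scalarMap_top]
  refine (isPushout_appTop_of_isPullback h).of_iso (Scheme.ΓSpecIso _) (Iso.refl _)
    (Scheme.ΓSpecIso _) (Iso.refl _) ?_ ?_ ?_ ?_ <;> simp

end LeibnizBaseChange

/-! ### Pullback of the distribution to a leaf -/

section Adjunction

variable {Y Z : Scheme.{u}} (f : Z ⟶ Y) {G : Y.Modules} {E : Z.Modules}

/-- `f^* G ⟶ E` is an isomorphism if and only if composition with the adjoint map `G ⟶ f_* E`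
identifies `Hom(E, N)` with `Hom(G, f_* N)` for all `N`. -/
theorem isIso_iff_bijective_homEquiv (φ : (Scheme.Modules.pullback f).obj G ⟶ E) :
    IsIso φ ↔ ∀ N : Z.Modules, Function.Bijective (fun h : E ⟶ N ↦
      (Scheme.Modules.pullbackPushforwardAdjunction f).homEquiv _ _ φ ≫
        (Scheme.Modules.pushforward f).map h) := by
  rw [isIso_iff_coyoneda_map_bijective]
  refine forall_congr' fun N ↦ ?_
  rw [← Function.Bijective.of_comp_iff'
    ((Scheme.Modules.pullbackPushforwardAdjunction f).homEquiv G N).bijective]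
  refine Eq.to_iff (congrArg _ (funext fun h ↦ ?_))
  exact Adjunction.homEquiv_naturality_right _ _ _

variable {k : Type u} [CommRing k] {p : Y ⟶ Spec (CommRingCat.of k)}
  {pZ : Z ⟶ Spec (CommRingCat.of k)}

/-- Commutativity of the square formed by `f^* Ω¹_Y ⟶ Ω¹_Z` and quotients of both sides, expressed
through the adjoint map `G ⟶ f_* E`. -/
theorem map_comp_eq_cotangentPullbackMap_comp_iff (hf : f ≫ p = pZ) (q : cotangentSheaf p ⟶ G)
    (q' : cotangentSheaf pZ ⟶ E) (φ : (Scheme.Modules.pullback f).obj G ⟶ E) :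
    (Scheme.Modules.pullback f).map q ≫ φ = cotangentPullbackMap pZ p f hf ≫ q' ↔
      ∀ (V : Y.Opens) (a : Γ(Y, V)),
        ((Scheme.Modules.pullbackPushforwardAdjunction f).homEquiv _ _ φ).app V (diff q V a) =
          diff q' (f ⁻¹ᵁ V) (f.app V a) := by
  rw [← ((Scheme.Modules.pullbackPushforwardAdjunction f).homEquiv _ _).apply_eq_iff_eq,
    Adjunction.homEquiv_naturality_left, Adjunction.homEquiv_naturality_right]
  rw [cotangentPullbackMap, Equiv.apply_symm_apply]
  refine ⟨fun h V a ↦ ?_, fun h ↦ cotangentSheaf_hom_ext fun V a ↦ ?_⟩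
  · refine (diff_comp q _ V a).symm.trans ?_
    rw [h, diff_comp, diff_cotangentDesc]
    rfl
  · rw [diff_comp, h, diff_comp, diff_cotangentDesc]
    rfl

theorem map_comp_eq_cotangentPullbackMap_comp_of_isAffine [IsAffine Y] (hf : f ≫ p = pZ)
    (q : cotangentSheaf p ⟶ G) (q' : cotangentSheaf pZ ⟶ E)
    (φ : (Scheme.Modules.pullback f).obj G ⟶ E)
    (h : ∀ a : Γ(Y, ⊤), ((Scheme.Modules.pullbackPushforwardAdjunction f).homEquiv _ _ φ).app ⊤
      (diff q ⊤ a) = diff q' ⊤ (f.appTop a)) :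
    (Scheme.Modules.pullback f).map q ≫ φ = cotangentPullbackMap pZ p f hf ≫ q' := by
  rw [← ((Scheme.Modules.pullbackPushforwardAdjunction f).homEquiv _ _).apply_eq_iff_eq,
    Adjunction.homEquiv_naturality_left, Adjunction.homEquiv_naturality_right]
  rw [cotangentPullbackMap, Equiv.apply_symm_apply]
  refine cotangentSheaf_hom_ext_of_isAffine fun a ↦ ?_
  rw [diff_comp, h, diff_comp, diff_cotangentDesc]
  rfl

theorem diff_relativeCotangentMap {L : Type u} [CommRing L] (r : Z ⟶ Spec (CommRingCat.of L))
    (t : Spec (CommRingCat.of L) ⟶ Spec (CommRingCat.of k)) (V : Z.Opens) (a : Γ(Z, V)) :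
    diff (relativeCotangentMap r t) V a = diff (𝟙 (cotangentSheaf r)) V a :=
  diff_cotangentDesc _ _ _

/-- Every module over the ring of global sections of an affine scheme is the module of global
sections of a sheaf of modules. -/
theorem exists_modules_top_addEquiv [IsAffine Z] (M : Type u) [AddCommGroup M] [Module Γ(Z, ⊤) M] :
    ∃ (N : Z.Modules) (e : Γ(N, ⊤) ≃+ M), ∀ (c : Γ(Z, ⊤)) (n : Γ(N, ⊤)), e (c • n) = c • e n := by
  let T := tilde (ModuleCat.of Γ(Z, ⊤) M)
  let e := (tilde.isoTop (ModuleCat.of Γ(Z, ⊤) M)).symm.toLinearEquiv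
  refine ⟨(Scheme.Modules.pushforward Z.isoSpec.inv).obj T, e.toAddEquiv, fun c n ↦ ?_⟩
  refine Eq.trans (congrArg e ?_) (e.map_smul c n)
  have h : Z.isoSpec.inv.appTop c = (Spec Γ(Z, ⊤)).presheaf.map (⊤ : (Spec Γ(Z, ⊤)).Opens).leTop.op
      ((Scheme.ΓSpecIso Γ(Z, ⊤)).inv c) := by
    have h1 : (Spec Γ(Z, ⊤)).presheaf.map (⊤ : (Spec Γ(Z, ⊤)).Opens).leTop.op = 𝟙 _ :=
      (Spec Γ(Z, ⊤)).presheaf.map_id _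
    rw [h1]
    have h2 : Z.isoSpec.inv.appTop = (Scheme.ΓSpecIso Γ(Z, ⊤)).inv := by
      rw [← cancel_epi (Scheme.ΓSpecIso Γ(Z, ⊤)).hom, Iso.hom_inv_id, ← Scheme.toSpecΓ_appTop,
        ← Scheme.Hom.comp_appTop,
        Scheme.isoSpec_inv_toSpecΓ, Scheme.Hom.id_appTop]
    rw [h2]; rfl
  exact congrArg (fun z : Γ(Spec Γ(Z, ⊤), ⊤) ↦ z • (show Γ(T, ⊤) from n)) h

end Adjunction

section WeaklyEtale

variable {k B L : Type u} [CommRing k] [CommRing B] [CommRing L] {Y Z : Scheme.{u}} [IsAffine Y]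
  [IsAffine Z] {p : Y ⟶ Spec (CommRingCat.of k)} {π : Y ⟶ Spec (CommRingCat.of B)}
  {f : Z ⟶ Y} {r : Z ⟶ Spec (CommRingCat.of L)}
  {t : Spec (CommRingCat.of L) ⟶ Spec (CommRingCat.of k)}
  {y : Spec (CommRingCat.of L) ⟶ Spec (CommRingCat.of B)} {G : Y.Modules}
  {q : cotangentSheaf p ⟶ G} (θ : cotangentSheaf π ≅ G)

/-- The fibre of `π` over a point `y` is tangent to the distribution: if `G` is the relative
cotangent sheaf of `π`, its pullback to the fibre is the cotangent sheaf of the fibre. By adjunction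
this says that derivations from the fibre over `L` and derivations from `Y` over `B` correspond to
each other, with values in any sheaf of modules on the fibre. -/
theorem exists_isIso_of_isPullback (hθ : ∀ U a, diff θ.hom U a = diff q U a)
    (hf : f ≫ p = r ≫ t) (h : IsPullback f r π y) :
    ∃ φ : (Scheme.Modules.pullback f).obj G ⟶ cotangentSheaf r, IsIso φ ∧
      (Scheme.Modules.pullback f).map q ≫ φ =
        cotangentPullbackMap (r ≫ t) p f hf ≫ relativeCotangentMap r t := by
  have H := isPushout_scalarMap h
  have hB (N : Z.Modules) (g : cotangentSheaf r ⟶ N) (b : B) :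
      diff g ⊤ (f.appTop (scalarMap π ⊤ b)) = 0 := by
    have := congr($(H.w) b)
    exact (congrArg (diff g ⊤) this).trans (diff_scalar g ⊤ _)
  obtain ⟨q₀, hq₀⟩ := exists_diff_top_eq (r := π)
    (N := (Scheme.Modules.pushforward f).obj (cotangentSheaf r))
    ((diff (𝟙 (cotangentSheaf r)) ⊤).comp f.appTop.hom.toAddMonoidHom)
    (fun a b ↦ (congrArg (diff (𝟙 (cotangentSheaf r)) ⊤) (map_mul f.appTop.hom a b)).trans
      (diff_mul _ _ _ _)) (hB _ (𝟙 (cotangentSheaf r)))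
  let ψ := θ.inv ≫ q₀
  have hψ (a : Γ(Y, ⊤)) :
      ψ.app ⊤ (diff θ.hom ⊤ a) = diff (𝟙 (cotangentSheaf r)) ⊤ (f.appTop a) := by
    refine (diff_comp θ.hom ψ ⊤ a).symm.trans ?_
    rw [Iso.hom_inv_id_assoc, hq₀]
    rfl
  have hψh (N : Z.Modules) (g : cotangentSheaf r ⟶ N) (a : Γ(Y, ⊤)) :
      diff (θ.hom ≫ ψ ≫ (Scheme.Modules.pushforward f).map g) ⊤ a = diff g ⊤ (f.appTop a) := by
    refine (diff_comp θ.hom _ ⊤ a).trans ?_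
    refine (congrArg (g.app ⊤) (hψ a)).trans ?_
    refine (diff_comp _ g ⊤ _).symm.trans ?_
    rw [Category.id_comp]
  refine ⟨((Scheme.Modules.pullbackPushforwardAdjunction f).homEquiv _ _).symm ψ, ?_, ?_⟩
  · rw [isIso_iff_bijective_homEquiv]
    intro N
    rw [Equiv.apply_symm_apply]
    refine ⟨fun g g' hg ↦ cotangentSheaf_hom_ext_of_isAffine fun c ↦ ?_, fun g ↦ ?_⟩
    · refine DFunLike.congr_fun (addMonoidHom_eq_of_isPushout H _ _ (diff_mul g ⊤) (diff_mul g' ⊤)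
        (diff_scalar g ⊤) (diff_scalar g' ⊤) fun a ↦ ?_) c
      rw [← hψh, ← hψh]
      exact congrArg (fun z ↦ diff (θ.hom ≫ z) ⊤ a) hg
    · obtain ⟨D, hD, hD0, hDa⟩ := exists_leibniz_of_isPushout (N := Γ(N, ⊤)) H
        (diff (θ.hom ≫ g) ⊤) (diff_mul (θ.hom ≫ g) ⊤) (diff_scalar (θ.hom ≫ g) ⊤)
      obtain ⟨g', hg'⟩ := exists_diff_top_eq D hD hD0
      refine ⟨g', ?_⟩
      rw [← cancel_epi θ.hom]
      refine cotangentSheaf_hom_ext_of_isAffine fun a ↦ ?_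
      refine (hψh _ _ _).trans ?_
      rw [hg']
      exact hDa a
  · refine map_comp_eq_cotangentPullbackMap_comp_of_isAffine f hf _ _ _ fun a ↦ ?_
    rw [Equiv.apply_symm_apply, diff_relativeCotangentMap, ← hθ, hψ]

variable {φ : (Scheme.Modules.pullback f).obj G ⟶ cotangentSheaf r} {hf : f ≫ p = r ≫ t}

omit [IsAffine Y] [IsAffine Z] in
/-- A first integral restricts to a function with zero differential on a leaf. -/
theorem diff_appTop_eq_zero
    (hφ : (Scheme.Modules.pullback f).map q ≫ φ =
      cotangentPullbackMap (r ≫ t) p f hf ≫ relativeCotangentMap r t)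
    (a : Γ(Y, ⊤)) (ha : diff q ⊤ a = 0) {N : Z.Modules} (g : cotangentSheaf r ⟶ N) :
    diff g ⊤ (f.appTop a) = 0 := by
  have h := (map_comp_eq_cotangentPullbackMap_comp_iff f hf q _ φ).mp hφ ⊤ a
  rw [ha, map_zero, diff_relativeCotangentMap] at h
  have := diff_comp (𝟙 _) g ⊤ (f.appTop a)
  rw [Category.id_comp] at this
  refine this.trans ((congrArg (g.app ⊤) h.symm).trans (map_zero _))

/-- If the pullback of `G` to `Z` is the cotangent sheaf of `Z` over `L`, then derivations from `Y`
over `B` with values in a module over the functions on `Z` extend to `Z`. -/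
theorem exists_leibniz_extension [IsIso φ] (hθ : ∀ U a, diff θ.hom U a = diff q U a)
    (hφ : (Scheme.Modules.pullback f).map q ≫ φ =
      cotangentPullbackMap (r ≫ t) p f hf ≫ relativeCotangentMap r t)
    (M : Type u) [AddCommGroup M] [Module Γ(Z, ⊤) M] (δ : Γ(Y, ⊤) →+ M)
    (hδ : ∀ a b, δ (a * b) = f.appTop a • δ b + f.appTop b • δ a)
    (hδ0 : ∀ b, δ (scalarMap π ⊤ b) = 0) :
    ∃ D : Γ(Z, ⊤) →+ M, (∀ a b, D (a * b) = a • D b + b • D a) ∧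
      (∀ c, D (scalarMap r ⊤ c) = 0) ∧ ∀ a, D (f.appTop a) = δ a := by
  obtain ⟨N, e, he⟩ := exists_modules_top_addEquiv (Z := Z) M
  have he' (c : Γ(Z, ⊤)) (m : M) : e.symm (c • m) = c • e.symm m := by
    rw [AddEquiv.symm_apply_eq, he, e.apply_symm_apply]
  obtain ⟨q₁, hq₁⟩ := exists_diff_top_eq (r := π) (N := (Scheme.Modules.pushforward f).obj N)
    (e.symm.toAddMonoidHom.comp δ)
    (fun a b ↦ by
      refine (congrArg e.symm (hδ a b)).trans ?_
      rw [map_add, he', he']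
      rfl) (fun b ↦ (congrArg e.symm (hδ0 b)).trans (map_zero _))
  obtain ⟨g, hg⟩ := ((isIso_iff_bijective_homEquiv f φ).mp ‹_› N).2 (θ.inv ≫ q₁)
  refine ⟨e.toAddMonoidHom.comp (diff g ⊤), fun a b ↦ ?_, fun c ↦ ?_, fun a ↦ ?_⟩
  · refine (congrArg e (diff_mul g ⊤ a b)).trans ?_
    rw [map_add, he, he]
    rfl
  · exact (congrArg e (diff_scalar g ⊤ c)).trans (map_zero _)
  · rw [← e.apply_symm_apply (δ a)]
    refine congrArg e (Eq.trans ?_ (hq₁ a))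
    have h := (map_comp_eq_cotangentPullbackMap_comp_iff f hf q _ φ).mp hφ ⊤ a
    rw [← hθ, diff_relativeCotangentMap] at h
    have h' := diff_comp (𝟙 _) g ⊤ (f.appTop a)
    rw [Category.id_comp] at h'
    refine h'.trans ((congrArg (g.app ⊤) h.symm).trans ?_)
    have hc : q₁ = θ.hom ≫ ((Scheme.Modules.pullbackPushforwardAdjunction f).homEquiv _ _) φ ≫
        (Scheme.Modules.pushforward f).map g := by
      rw [← Iso.inv_comp_eq]; exact hg.symm
    rw [hc]
    rfl

end WeaklyEtale

/-! ### Comparison with the relative cotangent sheaf -/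

section GenericDifferentials

/-- Differentials of a smooth domain inject into the differentials of its fraction field. -/
theorem map_injective_of_formallySmooth {B C K : Type*} [CommRing B] [CommRing C] [IsDomain C]
    [Field K] [Algebra B C] [Algebra C K] [Algebra B K] [IsScalarTower B C K]
    [IsFractionRing C K] [Algebra.FormallySmooth B C] :
    Function.Injective (KaehlerDifferential.map B B C K) := by
  have := KaehlerDifferential.isLocalizedModule_map B C K (nonZeroDivisors C)
  rw [injective_iff_map_eq_zero]
  intro ω hω
  obtain ⟨c, hc⟩ := (IsLocalizedModule.eq_zero_iff (nonZeroDivisors C)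
    (KaehlerDifferential.map B B C K)).mp hω
  exact (Module.Flat.isSMulRegular_of_nonZeroDivisors c.2).right_eq_zero_of_smul hc

/-- The differentials of the fraction field of a domain which is smooth of relative dimension `n`
over `B` have dimension `n`, as one sees on a standard smooth localization. -/
theorem finrank_kaehlerDifferential_fractionRing {B C K : Type u} [CommRing B] [CommRing C]
    [IsDomain C] [Field K] [Algebra B C] [Algebra C K] [Algebra B K] [IsScalarTower B C K]
    [IsFractionRing C K] {n : ℕ}
    (h : RingHom.Locally (RingHom.IsStandardSmoothOfRelativeDimension n) (algebraMap B C)) :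
    Module.Finite K Ω[K⁄B] ∧ Module.finrank K Ω[K⁄B] = n := by
  obtain ⟨s, hs, h⟩ := h
  obtain ⟨g, hg, hg0⟩ : ∃ g ∈ s, g ≠ 0 := by
    by_contra! h0
    have : Ideal.span s ≤ ⊥ := Ideal.span_le.mpr fun g hg ↦ h0 g hg
    rw [hs] at this
    exact top_ne_bot (le_bot_iff.mp this)
  have hsm := h g hg
  rw [← IsScalarTower.algebraMap_eq, RingHom.isStandardSmoothOfRelativeDimension_algebraMap] at hsm
  have hle : Submonoid.powers g ≤ nonZeroDivisors C :=
    powers_le_nonZeroDivisors_of_noZeroDivisors hg0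
  have : IsDomain (Localization.Away g) := IsLocalization.isDomain_localization hle
  let _ : Algebra (Localization.Away g) K :=
    IsLocalization.localizationAlgebraOfSubmonoidLe _ K _ _ hle
  have : IsScalarTower C (Localization.Away g) K :=
    IsLocalization.localization_isScalarTower_of_submonoid_le _ _ _ _ hle
  have : IsFractionRing (Localization.Away g) K :=
    IsFractionRing.isFractionRing_of_isDomain_of_isLocalization (Submonoid.powers g) _ _
  have : IsScalarTower B (Localization.Away g) K := .of_algebraMap_eq fun b ↦ by
    rw [IsScalarTower.algebraMap_apply B C K,
      IsScalarTower.algebraMap_apply C (Localization.Away g) K,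
      ← IsScalarTower.algebraMap_apply B C (Localization.Away g)]
  have : Algebra.FormallyEtale (Localization.Away g) K :=
    .of_isLocalization (nonZeroDivisors (Localization.Away g))
  have : Algebra.IsStandardSmooth B (Localization.Away g) := hsm.isStandardSmooth
  let e := (KaehlerDifferential.isBaseChange_of_formallyEtale B (Localization.Away g) K).equiv
  refine ⟨Module.Finite.equiv e, ?_⟩
  rw [← e.finrank_eq, Module.finrank_baseChange, Module.finrank,
    Algebra.IsStandardSmoothOfRelativeDimension.rank_kaehlerDifferential n, Cardinal.toNat_natCast]

end GenericDifferentials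

section StalkDerivation

variable {k : Type u} [CommRing k] {X : Scheme.{u}} {p : X ⟶ Spec (CommRingCat.of k)}
  {M : X.Modules} (q : cotangentSheaf p ⟶ M)

theorem res_mem_span_diff {U V : X.Opens} (i : V ⟶ U) {s : Γ(M, U)}
    (hs : s ∈ Submodule.span Γ(X, U) (Set.range (diff q U))) :
    M.presheaf.map i.op s ∈ Submodule.span Γ(X, V) (Set.range (diff q V)) := by
  induction hs using Submodule.span_induction with
  | mem m hm =>
    obtain ⟨a, rfl⟩ := hm
    exact Submodule.subset_span ⟨_, diff_res q i a⟩
  | zero => rw [map_zero]; exact zero_mem _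
  | add m m' _ _ hm hm' => rw [map_add]; exact add_mem hm hm'
  | smul a m _ hm => rw [Scheme.Modules.map_smul]; exact Submodule.smul_mem _ _ hm

theorem germ_smul (M : X.Modules) (x : X) (U : X.Opens) (hx : x ∈ U) (a : Γ(X, U)) (m : Γ(M, U)) :
    M.presheaf.germ U x hx (a • m) = X.presheaf.germ U x hx a • M.presheaf.germ U x hx m :=
  PresheafOfModules.germ_smul (R := X.presheaf) M.val x U hx a m

theorem exists_common_germ {x : X} (s t : X.presheaf.stalk x) : ∃ (U : X.Opens) (hx : x ∈ U)
    (a b : Γ(X, U)), X.presheaf.germ U x hx a = s ∧ X.presheaf.germ U x hx b = t := by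
  obtain ⟨U, hxU, a, rfl⟩ := X.presheaf.exists_germ_eq s
  obtain ⟨V, hxV, b, rfl⟩ := X.presheaf.exists_germ_eq t
  exact ⟨U ⊓ V, ⟨hxU, hxV⟩, X.presheaf.map (homOfLE inf_le_left).op a,
    X.presheaf.map (homOfLE inf_le_right).op b, X.presheaf.germ_res_apply _ x _ a,
    X.presheaf.germ_res_apply _ x _ b⟩

/-- The map on stalks induced by `q ∘ d`, with its Leibniz rule. -/
theorem exists_stalk_leibniz (x : X) :
    ∃ d : X.presheaf.stalk x →+ M.presheaf.stalk x, (∀ s t, d (s * t) = s • d t + t • d s) ∧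
      ∀ (U : X.Opens) (hx : x ∈ U) (a : Γ(X, U)),
        d (X.presheaf.germ U x hx a) = M.presheaf.germ U x hx (diff q U a) := by
  choose U hU a ha using X.presheaf.exists_germ_eq (x := x)
  let d (s : X.presheaf.stalk x) : M.presheaf.stalk x :=
    M.presheaf.germ (U s) x (hU s) (diff q _ (a s))
  have hd (V : X.Opens) (hx : x ∈ V) (b : Γ(X, V)) :
      d (X.presheaf.germ V x hx b) = M.presheaf.germ V x hx (diff q V b) := by
    obtain ⟨W, hxW, i, j, h⟩ := X.presheaf.germ_eq x (hU _) hx _ _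
      (ha (X.presheaf.germ V x hx b))
    change M.presheaf.germ _ x (hU _) (diff q _ (a _)) = _
    rw [← M.presheaf.germ_res_apply i x hxW, ← M.presheaf.germ_res_apply j x hxW]
    refine congrArg (M.presheaf.germ W x hxW) ?_
    refine (diff_res q i _).symm.trans (Eq.trans ?_ (diff_res q j _))
    exact congrArg (diff q W) h
  refine ⟨AddMonoidHom.mk' d fun s t ↦ ?_, fun s t ↦ ?_, hd⟩
  · obtain ⟨V, hx, b, c, rfl, rfl⟩ := exists_common_germ s t
    rw [← map_add, hd, hd, hd, map_add, map_add]
  · obtain ⟨V, hx, b, c, rfl, rfl⟩ := exists_common_germ s t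
    change d _ = _ • d _ + _ • d _
    rw [← map_mul, hd, hd, hd, diff_mul, map_add, germ_smul, germ_smul]

variable {B : Type u} [CommRing B] (π : X ⟶ Spec (CommRingCat.of B))

/-- The stalk of `𝒪_X` at `x` as an algebra over `B`, for a scheme `X` over `Spec B`. -/
noncomputable abbrev stalkAlgebra (x : X) : Algebra B (X.presheaf.stalk x) :=
  (scalarMap π ⊤ ≫ X.presheaf.germ ⊤ x trivial).hom.toAlgebra

theorem stalkAlgebra_algebraMap (x : X) (U : X.Opens) (hx : x ∈ U) (b : B) :
    (stalkAlgebra π x).algebraMap b = X.presheaf.germ U x hx (scalarMap π U b) := by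
  refine (X.presheaf.germ_res_apply (homOfLE (le_top : U ≤ ⊤)) x hx _).symm.trans ?_
  exact congrArg (X.presheaf.germ U x hx) congr($(scalarMap_res π (homOfLE (le_top : U ≤ ⊤))) b)

/-- If `q ∘ d` kills `B`, it induces a linear map from the differentials over `B` of the local
ring at `x` to the stalk of `M` at `x`. -/
theorem exists_kaehlerDifferential_stalk_map (x : X)
    (hB : ∀ b : B, diff q ⊤ (scalarMap π ⊤ b) = 0) :
    letI := stalkAlgebra π x
    ∃ μ : Ω[X.presheaf.stalk x⁄B] →ₗ[X.presheaf.stalk x] M.presheaf.stalk x,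
      ∀ (U : X.Opens) (hx : x ∈ U) (a : Γ(X, U)),
        μ (KaehlerDifferential.D B _ (X.presheaf.germ U x hx a)) =
          M.presheaf.germ U x hx (diff q U a) := by
  let _ := stalkAlgebra π x
  obtain ⟨d, hd, hdg⟩ := exists_stalk_leibniz q x
  let _ : Module B (M.presheaf.stalk x) := Module.compHom _ (algebraMap B (X.presheaf.stalk x))
  have : IsScalarTower B (X.presheaf.stalk x) (M.presheaf.stalk x) := .of_compHom _ _ _
  have h0 (b : B) : d (algebraMap B (X.presheaf.stalk x) b) = 0 := by
    refine (hdg ⊤ trivial (scalarMap π ⊤ b)).trans ?_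
    rw [hB, map_zero]
  let D : Derivation B (X.presheaf.stalk x) (M.presheaf.stalk x) :=
    { toFun := d
      map_add' := map_add d
      map_smul' := fun b a ↦ by
        rw [Algebra.smul_def, hd, h0, smul_zero, add_zero]; rfl
      map_one_eq_zero' := by
        change d 1 = 0
        rw [← map_one (algebraMap B (X.presheaf.stalk x)), h0]
      leibniz' := hd }
  exact ⟨D.liftKaehlerDifferential, fun U hx a ↦
    (D.liftKaehlerDifferential_comp_D _).trans (hdg U hx a)⟩

/-- Since `M` is locally generated by the sections `(q ∘ d) a`, so is its stalk at `x`. -/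
theorem surjective_of_forall_germ [Epi q] (x : X) {N : Type*} [AddCommGroup N]
    [Module (X.presheaf.stalk x) N] (μ : N →ₗ[X.presheaf.stalk x] M.presheaf.stalk x)
    (hμ : ∀ (U : X.Opens) (hx : x ∈ U) (a : Γ(X, U)),
      M.presheaf.germ U x hx (diff q U a) ∈ LinearMap.range μ) : Function.Surjective μ := by
  intro m
  obtain ⟨U, hxU, s, rfl⟩ := M.presheaf.exists_germ_eq m
  obtain ⟨V, i, hxV, hs⟩ := exists_res_mem_span_diff q U s x hxU
  rw [← M.presheaf.germ_res_apply i x hxV]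
  change _ ∈ LinearMap.range μ
  generalize M.presheaf.map i.op s = s' at hs
  induction hs using Submodule.span_induction with
  | mem m hm => obtain ⟨a, rfl⟩ := hm; exact hμ V hxV a
  | zero => rw [map_zero]; exact zero_mem _
  | add m m' _ _ hm hm' => rw [map_add]; exact add_mem hm hm'
  | smul a m _ hm => rw [germ_smul]; exact Submodule.smul_mem _ _ hm

end StalkDerivation

section LeafwiseCotangent

variable {k B : Type u} [CommRing k] [CommRing B] {Y : Scheme.{u}} [IsAffine Y]
  {p : Y ⟶ Spec (CommRingCat.of k)} {π : Y ⟶ Spec (CommRingCat.of B)} {M N : Y.Modules}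

variable [AlgebraicGeometry.IsIntegral Y] (q : cotangentSheaf p ⟶ M) [Epi q] {n : ℕ}

omit [IsAffine Y] [AlgebraicGeometry.IsIntegral Y] in
theorem smooth_scalarMap [Smooth π] {U : Y.Opens} (hU : IsAffineOpen U) :
    (scalarMap π U).hom.Smooth :=
  RingHom.Smooth.respectsIso.2 _
    (Scheme.ΓSpecIso (CommRingCat.of B)).symm.commRingCatIsoToRingEquiv
    (π.smooth_appLE (isAffineOpen_top _) hU le_top)

omit [IsAffine Y] [AlgebraicGeometry.IsIntegral Y] in
theorem locally_scalarMap [h : SmoothOfRelativeDimension n π] {U : Y.Opens} (hU : IsAffineOpen U) :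
    RingHom.Locally (RingHom.IsStandardSmoothOfRelativeDimension n) (scalarMap π U).hom :=
  (RingHom.locally_respectsIso RingHom.isStandardSmoothOfRelativeDimension_respectsIso).2 _
    (Scheme.ΓSpecIso (CommRingCat.of B)).symm.commRingCatIsoToRingEquiv
    (HasRingHomProperty.appLE _ _ h ⟨⊤, isAffineOpen_top _⟩ ⟨U, hU⟩ le_top)

omit [IsAffine Y] in
theorem isScalarTower_stalk (U : Y.Opens) (hU : genericPoint Y ∈ U) :
    letI := (scalarMap π U).hom.toAlgebra
    letI := (Y.presheaf.germ U (genericPoint Y) hU).hom.toAlgebra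
    letI := stalkAlgebra π (genericPoint Y)
    IsScalarTower B Γ(Y, U) (Y.presheaf.stalk (genericPoint Y)) :=
  letI := (scalarMap π U).hom.toAlgebra
  letI := (Y.presheaf.germ U (genericPoint Y) hU).hom.toAlgebra
  letI := stalkAlgebra π (genericPoint Y)
  .of_algebraMap_eq fun b ↦ stalkAlgebra_algebraMap π _ U hU b

/-- At the generic point, the relative differentials of `π` map onto the stalk of `M`, and
injectively so because both have dimension `n`. -/
theorem exists_injective_kaehlerDifferential_stalk_map [SmoothOfRelativeDimension n π]
    (hB : ∀ b : B, diff q ⊤ (scalarMap π ⊤ b) = 0)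
    (hn : Module.finrank (Y.presheaf.stalk (genericPoint Y))
      (M.presheaf.stalk (genericPoint Y)) = n) :
    letI := stalkAlgebra π (genericPoint Y)
    ∃ μ : Ω[Y.presheaf.stalk (genericPoint Y)⁄B] →ₗ[Y.presheaf.stalk (genericPoint Y)]
        M.presheaf.stalk (genericPoint Y), Function.Injective μ ∧
      ∀ (U : Y.Opens) (hx : genericPoint Y ∈ U) (a : Γ(Y, U)),
        μ (KaehlerDifferential.D B _ (Y.presheaf.germ U (genericPoint Y) hx a)) =
          M.presheaf.germ U (genericPoint Y) hx (diff q U a) := by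
  let _ := stalkAlgebra π (genericPoint Y)
  obtain ⟨μ, hμ⟩ := exists_kaehlerDifferential_stalk_map q π (genericPoint Y) hB
  refine ⟨μ, ?_, hμ⟩
  have hsurj := surjective_of_forall_germ q _ μ fun U hx a ↦ ⟨_, hμ U hx a⟩
  let _ : Field (Y.presheaf.stalk (genericPoint Y)) := inferInstanceAs (Field Y.functionField)
  let _ := (scalarMap π ⊤).hom.toAlgebra
  let _ := (Y.presheaf.germ ⊤ (genericPoint Y) trivial).hom.toAlgebra
  have := isScalarTower_stalk (π := π) ⊤ trivial
  have : Nonempty (⊤ : Y.Opens) := ⟨⟨genericPoint Y, trivial⟩⟩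
  have : IsFractionRing Γ(Y, ⊤) (Y.presheaf.stalk (genericPoint Y)) :=
    functionField_isFractionRing_of_isAffineOpen Y _ (isAffineOpen_top Y)
  obtain ⟨hfin, hrank⟩ := finrank_kaehlerDifferential_fractionRing (B := B) (C := Γ(Y, ⊤))
    (K := Y.presheaf.stalk (genericPoint Y))
    (locally_scalarMap (n := n) (π := π) (isAffineOpen_top Y))
  have : Module.Finite (Y.presheaf.stalk (genericPoint Y)) (M.presheaf.stalk (genericPoint Y)) :=
    .of_surjective μ hsurj
  exact (LinearMap.injective_iff_surjective_of_finrank_eq_finrank (hrank.trans hn.symm)).mpr hsurj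

/-- If `π` is smooth of relative dimension the rank of `M` and `q ∘ d` kills the functions on the
base, then `M` is the relative cotangent sheaf of `π`. The comparison map is an epimorphism because
`q` is, and a monomorphism because it is injective at the generic point and relative differentials
of a smooth morphism embed in their generic stalk. -/
theorem exists_cotangentSheaf_iso [SmoothOfRelativeDimension n π]
    (hB : ∀ b : B, diff q ⊤ (scalarMap π ⊤ b) = 0)
    (hn : Module.finrank (Y.presheaf.stalk (genericPoint Y))
      (M.presheaf.stalk (genericPoint Y)) = n) :
    ∃ θ : cotangentSheaf π ≅ M, ∀ U a, diff θ.hom U a = diff q U a := by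
  obtain ⟨θ, hθ⟩ := exists_diff_top_eq (r := π) (diff q ⊤) (diff_mul q ⊤) hB
  replace hθ := diff_eq_diff_of_isAffine hθ
  have hepi : Epi θ := Preadditive.epi_of_cancel_zero _ fun g hg ↦ by
    refine hom_ext_of_epi q fun U a ↦ ?_
    rw [← hθ, ← diff_comp, hg]
    rfl
  let _ := stalkAlgebra π (genericPoint Y)
  obtain ⟨μ, hinj, hμ⟩ := exists_injective_kaehlerDifferential_stalk_map q hB hn
  let _ : Field (Y.presheaf.stalk (genericPoint Y)) := inferInstanceAs (Field Y.functionField)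
  have : Smooth π := SmoothOfRelativeDimension.smooth n π
  -- A section killed by `θ` is locally given by a differential form, which vanishes generically.
  have hzero (W : Y.Opens) (ω : Γ(cotangentSheaf π, W)) (hω : θ.app W ω = 0) : ω = 0 := by
    refine TopCat.Presheaf.IsSheaf.section_ext (cotangentSheaf π).isSheaf fun x hx ↦ ?_
    obtain ⟨V', i, hxV', hV'⟩ := exists_res_mem_span_diff (𝟙 (cotangentSheaf π)) W ω x hx
    obtain ⟨V, hV, hxV, hle⟩ := exists_isAffineOpen_mem_and_subset hxV'
    let j : V ⟶ V' := homOfLE hle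
    refine ⟨V, leOfHom (j ≫ i), hxV, ?_⟩
    change (cotangentSheaf π).presheaf.map (j ≫ i).op ω =
      (cotangentSheaf π).presheaf.map (j ≫ i).op 0
    have hη : genericPoint Y ∈ V :=
      ((genericPoint_spec Y).mem_open_set_iff V.isOpen).mpr ⟨x, trivial, hxV⟩
    let _ := (scalarMap π V).hom.toAlgebra
    let _ := (Y.presheaf.germ V (genericPoint Y) hη).hom.toAlgebra
    have := isScalarTower_stalk (π := π) V hη
    have : Nonempty V := ⟨⟨x, hxV⟩⟩
    have : IsFractionRing Γ(Y, V) (Y.presheaf.stalk (genericPoint Y)) :=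
      functionField_isFractionRing_of_isAffineOpen Y V hV
    have : Algebra.Smooth B Γ(Y, V) := smooth_scalarMap hV
    obtain ⟨g, hgD, hg⟩ := exists_kaehlerDifferential_map (𝟙 (cotangentSheaf π)) V
    have hspan := res_mem_span_diff (𝟙 (cotangentSheaf π)) j hV'
    rw [← hg, ← ConcreteCategory.comp_apply, ← Functor.map_comp] at hspan
    obtain ⟨ω', hω'⟩ := hspan
    have hcomm (τ : Ω[Γ(Y, V)⁄B]) :
        μ (KaehlerDifferential.map B B Γ(Y, V) (Y.presheaf.stalk (genericPoint Y)) τ) =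
          M.presheaf.germ V (genericPoint Y) hη (θ.app V (g τ)) := by
      have hτ : τ ∈ Submodule.span Γ(Y, V) (Set.range (KaehlerDifferential.D B Γ(Y, V))) := by
        rw [KaehlerDifferential.span_range_derivation]; trivial
      induction hτ using Submodule.span_induction with
      | mem τ hτ =>
        obtain ⟨a, rfl⟩ := hτ
        rw [KaehlerDifferential.map_D, hgD, ← diff_comp, Category.id_comp, hθ]
        exact hμ V hη a
      | zero => simp only [map_zero]
      | add τ τ' _ _ h h' => simp only [map_add, h, h']
      | smul a τ _ h =>
        rw [(KaehlerDifferential.map B B Γ(Y, V) _).map_smul, g.map_smul,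
          Scheme.Modules.Hom.app_smul, germ_smul, ← h,
          algebra_compatible_smul (Y.presheaf.stalk (genericPoint Y)) a, μ.map_smul]
        rfl
    have hzero' : ω' = 0 := by
      apply map_injective_of_formallySmooth (B := B) (K := Y.presheaf.stalk (genericPoint Y))
      apply hinj
      rw [hcomm, hω']
      have : θ.app V ((cotangentSheaf π).presheaf.map (j ≫ i).op ω) = 0 := by
        rw [app_res, hω, map_zero]
      refine (congrArg (M.presheaf.germ V (genericPoint Y) hη) this).trans ?_
      simp only [map_zero]
    rw [map_zero]
    refine hω'.symm.trans ?_
    rw [hzero', map_zero]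
  have hmono : Mono θ := Preadditive.mono_of_cancel_zero _ fun {Z} g hg ↦ by
    ext U s
    exact hzero U _ congr($(hg).app U s)
  have := isIso_of_mono_of_epi θ
  exact ⟨asIso θ, hθ⟩

end LeafwiseCotangent

/-! ### Fibres of the quotient map -/

section Fibres

variable {B : Type u} [CommRing B] {Y : Scheme.{u}} [IsAffine Y]
  {π : Y ⟶ Spec (CommRingCat.of B)}

/-- The fibres of `π` over points with values in fields are smooth and connected, hence integral. -/
theorem isIntegral_of_isPullback [Smooth π] [GeometricallyConnected π] {K : Type u} [Field K]
    {Z : Scheme.{u}} {f : Z ⟶ Y} {r : Z ⟶ Spec (CommRingCat.of K)}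
    {y : Spec (CommRingCat.of K) ⟶ Spec (CommRingCat.of B)} (h : IsPullback f r π y) :
    AlgebraicGeometry.IsIntegral Z := by
  have : IsAffine Z := .of_isPullback h
  have : Smooth r := MorphismProperty.of_isPullback (P := @Smooth) h ‹_›
  have hc : ConnectedSpace Z :=
    GeometricallyConnected.geometrically_connectedSpace (f := π) y f r h
  have : ConnectedSpace (PrimeSpectrum Γ(Z, ⊤)) :=
    Z.isoSpec.hom.homeomorph.surjective.connectedSpace Z.isoSpec.hom.homeomorph.continuous
  let _ := (scalarMap r ⊤).hom.toAlgebra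
  have : Algebra.Smooth K Γ(Z, ⊤) := smooth_scalarMap (isAffineOpen_top Z)
  have : IsDomain Γ(Z, ⊤) := isDomain_of_smooth_of_connectedSpace (K := K)
  exact isIntegral_of_isAffine_of_isDomain Z

theorem isDomain_tensorProduct [Smooth π] [GeometricallyConnected π] (K : Type u) [Field K]
    [Algebra B K] :
    letI := (scalarMap π ⊤).hom.toAlgebra
    IsDomain (Γ(Y, ⊤) ⊗[B] K) := by
  let _ := (scalarMap π ⊤).hom.toAlgebra
  let y : Spec (CommRingCat.of K) ⟶ Spec (CommRingCat.of B) :=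
    Spec.map (CommRingCat.ofHom (algebraMap B K))
  have h := IsPullback.of_hasPullback π y
  have := isIntegral_of_isPullback h
  have H := isPushout_scalarMap h
  have hy : (Scheme.ΓSpecIso (CommRingCat.of B)).inv ≫ y.appTop ≫
      (Scheme.ΓSpecIso (CommRingCat.of K)).hom = CommRingCat.ofHom (algebraMap B K) := by
    rw [Iso.inv_comp_eq]
    exact Scheme.ΓSpecIso_naturality _
  rw [hy] at H
  let e := ((CommRingCat.isPushout_tensorProduct B Γ(Y, ⊤) K).isoIsPushout
    _ _ H).commRingCatIsoToRingEquiv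
  have : Nonempty (⊤ : (pullback π y).Opens) := ⟨⟨Nonempty.some inferInstance, trivial⟩⟩
  exact e.injective.isDomain e.toRingHom

theorem geometricallyIntegral_of_isPullback [Smooth π] [GeometricallyConnected π] {Z W : Scheme.{u}}
    {f : Z ⟶ Y} {r : Z ⟶ W} {y : W ⟶ Spec (CommRingCat.of B)} (h : IsPullback f r π y) :
    GeometricallyIntegral r :=
  ⟨fun _ _ _ _ _ _ h' ↦ isIntegral_of_isPullback (h'.paste_horiz h)⟩

end Fibres

/-! ### Local first integrals -/

section LocalFirstIntegrals

theorem stalkMap_injective {X Y : Scheme.{u}} (f : X ⟶ Y) [Flat f] (x : X) :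
    Function.Injective (f.stalkMap x) := by
  algebraize [(f.stalkMap x).hom]
  have : Module.FaithfullyFlat (Y.presheaf.stalk (f x)) (X.presheaf.stalk x) :=
    @Module.FaithfullyFlat.of_flat_of_isLocalHom _ _ _ _ _ _ _ (Flat.stalkMap f x)
      (f.toLRSHom.prop x)
  exact FaithfulSMul.algebraMap_injective _ (X.presheaf.stalk x)

variable {k B : Type u} [CommRing k] [CommRing B] [CharZero B] {Y : Scheme.{u}} [IsAffine Y]
  [AlgebraicGeometry.IsIntegral Y]
  {p : Y ⟶ Spec (CommRingCat.of k)} {π : Y ⟶ Spec (CommRingCat.of B)} {M : Y.Modules}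
  (q : cotangentSheaf p ⟶ M)

/-- A rational function on `Y` with vanishing relative differential is the quotient of two functions
on the base: it is algebraic over the function field of the base, which is algebraically closed in
that of `Y`. -/
theorem exists_mul_eq_of_D_eq_zero [Smooth π] [GeometricallyConnected π]
    (hinj : Function.Injective (scalarMap π ⊤)) (s : Y.presheaf.stalk (genericPoint Y))
    (hs : letI := stalkAlgebra π (genericPoint Y)
      KaehlerDifferential.D B (Y.presheaf.stalk (genericPoint Y)) s = 0) :
    ∃ b b' : B, b' ≠ 0 ∧ (stalkAlgebra π (genericPoint Y)).algebraMap b =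
      (stalkAlgebra π (genericPoint Y)).algebraMap b' * s := by
  let _ : Field (Y.presheaf.stalk (genericPoint Y)) := inferInstanceAs (Field Y.functionField)
  let _ := stalkAlgebra π (genericPoint Y)
  let _ := (scalarMap π ⊤).hom.toAlgebra
  let _ := (Y.presheaf.germ ⊤ (genericPoint Y) trivial).hom.toAlgebra
  have := isScalarTower_stalk (π := π) ⊤ trivial
  have : Nonempty (⊤ : Y.Opens) := ⟨⟨genericPoint Y, trivial⟩⟩
  have : IsFractionRing Γ(Y, ⊤) (Y.presheaf.stalk (genericPoint Y)) :=
    functionField_isFractionRing_of_isAffineOpen Y _ (isAffineOpen_top Y)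
  have : IsDomain B := hinj.isDomain (scalarMap π ⊤).hom
  have : FaithfulSMul B (Y.presheaf.stalk (genericPoint Y)) := by
    rw [faithfulSMul_iff_algebraMap_injective]
    exact (IsFractionRing.injective Γ(Y, ⊤) (Y.presheaf.stalk (genericPoint Y))).comp hinj
  let _ : Algebra (FractionRing B) (Y.presheaf.stalk (genericPoint Y)) :=
    FractionRing.liftAlgebra B _
  have : IsScalarTower B (FractionRing B) (Y.presheaf.stalk (genericPoint Y)) :=
    FractionRing.isScalarTower_liftAlgebra B _
  have hD : KaehlerDifferential.D (FractionRing B) (Y.presheaf.stalk (genericPoint Y)) s = 0 := by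
    have := KaehlerDifferential.map_D B (FractionRing B) (Y.presheaf.stalk (genericPoint Y))
      (Y.presheaf.stalk (genericPoint Y)) s
    rw [hs, map_zero] at this
    exact this.symm
  have : CharZero (FractionRing B) :=
    charZero_of_injective_algebraMap (IsFractionRing.injective B (FractionRing B))
  have : IsDomain (Γ(Y, ⊤) ⊗[B] AlgebraicClosure (FractionRing B)) := isDomain_tensorProduct _
  obtain ⟨x, rfl⟩ := mem_range_algebraMap_of_isAlgebraic (B := B) (A := Γ(Y, ⊤))
    (Ω := AlgebraicClosure (FractionRing B)) s (isAlgebraic_of_D_eq_zero s hD)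
  obtain ⟨b, b', rfl⟩ := IsLocalization.exists_mk'_eq (nonZeroDivisors B) x
  refine ⟨b, b', nonZeroDivisors.ne_zero b'.2, ?_⟩
  change algebraMap B (Y.presheaf.stalk (genericPoint Y)) b =
    algebraMap B (Y.presheaf.stalk (genericPoint Y)) b' * _
  rw [IsScalarTower.algebraMap_apply B (FractionRing B),
    IsScalarTower.algebraMap_apply B (FractionRing B)
    (Y.presheaf.stalk (genericPoint Y)) b', ← map_mul, mul_comm, IsLocalization.mk'_spec]

omit [CharZero B] [IsAffine Y] [AlgebraicGeometry.IsIntegral Y] in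
theorem stalkMap_germ_scalar (y : Y) (U : Y.Opens) (hy : y ∈ U) (b : B) :
    π.stalkMap y ((Spec (CommRingCat.of B)).presheaf.germ ⊤ (π y) trivial
      ((Scheme.ΓSpecIso (CommRingCat.of B)).inv b)) =
      Y.presheaf.germ U y hy (scalarMap π U b) := by
  refine (π.germ_stalkMap_apply ⊤ y trivial _).trans
    (Eq.trans ?_ (stalkAlgebra_algebraMap π y U hy b))
  exact congrArg (Y.presheaf.germ ⊤ y trivial) congr($(scalarMap_top π) b).symm

/-- The local first integrals at `y` are the germs of functions on the base. A first integral is a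
quotient of functions on the base by `exists_mul_eq_of_D_eq_zero`, and this quotient is regular on
the base at `π y` by faithful flatness of the local rings. -/
theorem range_stalkMap_eq [Smooth π] [GeometricallyConnected π]
    (hinj : Function.Injective (scalarMap π ⊤)) (hB : ∀ b : B, diff q ⊤ (scalarMap π ⊤ b) = 0)
    (hμ : letI := stalkAlgebra π (genericPoint Y)
      ∃ μ : Ω[Y.presheaf.stalk (genericPoint Y)⁄B] →ₗ[Y.presheaf.stalk (genericPoint Y)]
        M.presheaf.stalk (genericPoint Y), Function.Injective μ ∧
      ∀ (U : Y.Opens) (hx : genericPoint Y ∈ U) (a : Γ(Y, U)),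
        μ (KaehlerDifferential.D B _ (Y.presheaf.germ U (genericPoint Y) hx a)) =
          M.presheaf.germ U (genericPoint Y) hx (diff q U a)) (y : Y) :
    (π.stalkMap y).hom.range = localFirstIntegrals q y := by
  let _ := stalkAlgebra π (genericPoint Y)
  obtain ⟨μ, hμinj, hμ⟩ := hμ
  ext s
  constructor
  · rintro ⟨r, rfl⟩
    obtain ⟨d, hd, hdg⟩ := exists_stalk_leibniz q y
    have h0 (c : Γ(Spec (CommRingCat.of B), ⊤)) :
        d (π.stalkMap y ((Spec (CommRingCat.of B)).presheaf.germ ⊤ (π y) trivial c)) = 0 := by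
      obtain ⟨b, rfl⟩ :=
        (Scheme.ΓSpecIso (CommRingCat.of B)).symm.commRingCatIsoToRingEquiv.surjective c
      refine (congrArg d (stalkMap_germ_scalar y ⊤ trivial b)).trans ?_
      exact (hdg ⊤ trivial _).trans ((congrArg _ (hB b)).trans (map_zero _))
    let _ := (Spec (CommRingCat.of B)).presheaf.algebra_section_stalk
      (⟨π y, trivial⟩ : (⊤ : (Spec (CommRingCat.of B)).Opens))
    have hloc := (isAffineOpen_top (Spec (CommRingCat.of B))).isLocalization_stalk ⟨π y, trivial⟩
    obtain ⟨⟨b, c⟩, hbc⟩ := IsLocalization.surj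
      ((isAffineOpen_top (Spec (CommRingCat.of B))).primeIdealOf
        ⟨π y, trivial⟩).asIdeal.primeCompl r
    have hc := IsLocalization.map_units ((Spec (CommRingCat.of B)).presheaf.stalk (π y)) c
    have hs : d (π.stalkMap y r) = 0 := by
      have h1 := congrArg (fun z ↦ d (π.stalkMap y z)) hbc
      dsimp only at h1
      rw [map_mul, hd] at h1
      replace h1 := h1.trans (h0 b)
      have h2 : d (π.stalkMap y (algebraMap _ _ (c : Γ(Spec (CommRingCat.of B), ⊤)))) = 0 := h0 c
      rw [h2, smul_zero, zero_add] at h1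
      exact ((hc.map (π.stalkMap y).hom).smul_eq_zero).mp h1
    obtain ⟨V, hyV, a, ha⟩ := Y.presheaf.exists_germ_eq (π.stalkMap y r)
    refine ⟨V, hyV, a, ha, ?_⟩
    rw [← hdg, ha, hs]
  · intro hs
    obtain ⟨V, hyV, a, rfl, ha⟩ := exists_nhd_diff_eq_zero q y hs
    have hηV : genericPoint Y ∈ V :=
      ((genericPoint_spec Y).mem_open_set_iff V.isOpen).mpr ⟨y, trivial, hyV⟩
    have hD : KaehlerDifferential.D B _ (Y.presheaf.germ V (genericPoint Y) hηV a) = 0 := by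
      apply hμinj
      rw [hμ, ha, map_zero, map_zero]
    obtain ⟨b, b', hb', h⟩ := exists_mul_eq_of_D_eq_zero hinj _ hD
    rw [stalkAlgebra_algebraMap π _ V hηV, stalkAlgebra_algebraMap π _ V hηV, ← map_mul] at h
    replace h := germ_injective_of_isIntegral Y _ hηV h
    algebraize [(π.stalkMap y).hom]
    have : IsLocalHom (algebraMap ((Spec (CommRingCat.of B)).presheaf.stalk (π y))
      (Y.presheaf.stalk y)) := π.toLRSHom.prop y
    have : Module.Flat ((Spec (CommRingCat.of B)).presheaf.stalk (π y)) (Y.presheaf.stalk y) :=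
      Flat.stalkMap π y
    refine exists_algebraMap_eq_of_mul_eq
      ((Spec (CommRingCat.of B)).presheaf.germ ⊤ (π y) trivial
        ((Scheme.ΓSpecIso (CommRingCat.of B)).inv b))
      ((Spec (CommRingCat.of B)).presheaf.germ ⊤ (π y) trivial
        ((Scheme.ΓSpecIso (CommRingCat.of B)).inv b')) ?_ _ ?_
    · intro h0
      apply hb'
      have h1 := stalkMap_germ_scalar (π := π) y ⊤ trivial b'
      rw [h0, map_zero] at h1
      apply hinj
      apply germ_injective_of_isIntegral Y y (U := ⊤) trivial
      rw [← h1, map_zero, map_zero]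
    · refine (stalkMap_germ_scalar y V hyV b).trans ?_
      rw [h, map_mul]
      exact congrArg (· * _) (stalkMap_germ_scalar y V hyV b').symm

end LocalFirstIntegrals

/-! ### Leaves as fibres -/

section Separability

/-- In characteristic zero any transcendence basis separates. -/
theorem isSeparableExtension_of_charZero (k K : Type u) [Field k] [Field K] [Algebra k K]
    [CharZero k] : IsSeparableExtension k K := fun E _ ↦ by
  obtain ⟨s, hs⟩ := exists_isTranscendenceBasis k E
  have : Algebra.IsAlgebraic (IntermediateField.adjoin k s) E := by
    have h := hs.isAlgebraic_field
    rwa [Subtype.range_coe] at h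
  exact ⟨s, hs, inferInstance⟩

theorem universallySeparable_of_charZero {k : Type u} [Field k] [CharZero k] {X Y : Scheme.{u}}
    (f : X ⟶ Y) (p : Y ⟶ Spec (CommRingCat.of k)) : universallySeparable f := by
  intro X' Y' i₁ i₂ f' _ x
  let ρ : k →+* Y'.residueField (f' x) :=
    (scalarMap (i₂ ≫ p) ⊤ ≫ Y'.presheaf.germ ⊤ (f' x) trivial ≫ Y'.residue (f' x)).hom
  have : CharZero (Y'.residueField (f' x)) := charZero_of_injective_ringHom ρ.injective
  let _ := (f'.residueFieldMap x).hom.toAlgebra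
  exact isSeparableExtension_of_charZero _ _

end Separability

section AffineMorphisms

variable {B L : Type u} [CommRing B] [CommRing L] {Y Z : Scheme.{u}}
  {π : Y ⟶ Spec (CommRingCat.of B)} {f : Z ⟶ Y} {r : Z ⟶ Spec (CommRingCat.of L)}

theorem comp_eq_comp_of_scalarMap (β : B →+* L)
    (h : ∀ b, f.appTop (scalarMap π ⊤ b) = scalarMap r ⊤ (β b)) :
    r ≫ Spec.map (CommRingCat.ofHom β) = f ≫ π := by
  refine ext_of_isAffine ?_
  rw [← cancel_epi (Scheme.ΓSpecIso (CommRingCat.of B)).inv, Scheme.Hom.comp_appTop,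
    Scheme.Hom.comp_appTop]
  rw [← Scheme.ΓSpecIso_inv_naturality_assoc, ← scalarMap_top, ← Category.assoc, ← scalarMap_top]
  ext b
  exact (h b).symm

end AffineMorphisms

section Leaves

variable {k B L : Type u} [Field k] [CharZero k] [CommRing B] [Field L]
  {Y Z : Scheme.{u}} [IsAffine Y]
  {p : Y ⟶ Spec (CommRingCat.of k)} {π : Y ⟶ Spec (CommRingCat.of B)}
  {pB : Spec (CommRingCat.of B) ⟶ Spec (CommRingCat.of k)}
  {t : Spec (CommRingCat.of L) ⟶ Spec (CommRingCat.of k)}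
  {y : Spec (CommRingCat.of L) ⟶ Spec (CommRingCat.of B)} {G : Y.Modules}
  {q : cotangentSheaf p ⟶ G} (θ : cotangentSheaf π ≅ G)

omit [CharZero k] [IsAffine Y] in
/-- The fibre of `π` over `y` is a closed subscheme of `Y ×_k Spec L`, the base being separated
over `k`. -/
theorem isClosedImmersion_lift (hp : π ≫ pB = p) (hy : y ≫ pB = t) :
    IsClosedImmersion (pullback.lift (f := p) (g := t) (pullback.fst π y) (pullback.snd π y)
      (by rw [← hp, ← hy, pullback.condition_assoc])) := by
  subst hp hy
  convert (inferInstance : IsClosedImmersion (pullback.mapDesc π y pB)) using 2 <;>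
    exact (Category.comp_id _).symm

/-- The fibres of `π` over geometric points are leaves. -/
theorem isSmoothFamilyOfLeaves_of_isPullback [Smooth π] [GeometricallyConnected π]
    (hθ : ∀ U a, diff θ.hom U a = diff q U a) (i : Z ⟶ pullback p t) [IsClosedImmersion i]
    (h : IsPullback (i ≫ pullback.fst p t) (i ≫ pullback.snd p t) π y) :
    IsSmoothFamilyOfLeaves q t i where
  closedImmersion := ‹_›
  smooth := MorphismProperty.of_isPullback (P := @Smooth) h ‹_›
  geometricallyIntegral := geometricallyIntegral_of_isPullback h
  weaklyEtale := by
    have : IsAffine Z := .of_isPullback h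
    exact ⟨universallySeparable_of_charZero _ p, exists_isIso_of_isPullback θ hθ _ h⟩

omit [CharZero k] [IsAffine Y] in
/-- First integrals are constant on leaves: the restriction to the integral scheme `Z` has zero
differential, so it is algebraic over the algebraically closed field `L`. -/
theorem appTop_mem_range_of_diff_eq_zero [IsAlgClosed L] [CharZero L] [IsAffine Z]
    [AlgebraicGeometry.IsIntegral Z] {f : Z ⟶ Y} {r : Z ⟶ Spec (CommRingCat.of L)}
    {hf : f ≫ p = r ≫ t} {φ : (Scheme.Modules.pullback f).obj G ⟶ cotangentSheaf r}
    (hφ : (Scheme.Modules.pullback f).map q ≫ φ =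
      cotangentPullbackMap (r ≫ t) p f hf ≫ relativeCotangentMap r t)
    (a : Γ(Y, ⊤)) (ha : diff q ⊤ a = 0) :
    ∃ c : L, f.appTop a = scalarMap r ⊤ c := by
  let _ := (scalarMap r ⊤).hom.toAlgebra
  have : Nonempty (⊤ : Z.Opens) := ⟨⟨Nonempty.some inferInstance, trivial⟩⟩
  obtain ⟨N, e, he⟩ := exists_modules_top_addEquiv (Z := Z) Ω[Γ(Z, ⊤)⁄L]
  have he' (c : Γ(Z, ⊤)) (m : Ω[Γ(Z, ⊤)⁄L]) : e.symm (c • m) = c • e.symm m := by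
    rw [AddEquiv.symm_apply_eq, he, e.apply_symm_apply]
  let D := KaehlerDifferential.D L Γ(Z, ⊤)
  obtain ⟨g, hg⟩ := exists_diff_top_eq (r := r) (N := N)
    (e.symm.toAddMonoidHom.comp D.toLinearMap.toAddMonoidHom)
    (fun a b ↦ by
      refine (congrArg e.symm (D.leibniz a b)).trans ?_
      rw [map_add, he', he']
      rfl) (fun c ↦ (congrArg e.symm (D.map_algebraMap c)).trans (map_zero _))
  have hD : D (f.appTop a) = 0 := by
    have := (hg _).symm.trans (diff_appTop_eq_zero hφ a ha g)
    exact (AddEquiv.map_eq_zero_iff e.symm).mp this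
  let K := FractionRing Γ(Z, ⊤)
  have hDK : KaehlerDifferential.D L K (algebraMap Γ(Z, ⊤) K (f.appTop a)) = 0 := by
    rw [← KaehlerDifferential.map_D L L Γ(Z, ⊤) K]
    exact (congrArg _ hD).trans (map_zero _)
  have hint := (isAlgebraic_of_D_eq_zero _ hDK).isIntegral
  obtain ⟨c, hc⟩ := minpoly.mem_range_of_degree_eq_one L _
    (IsAlgClosed.degree_eq_one_of_irreducible L (minpoly.irreducible hint))
  refine ⟨c, IsFractionRing.injective Γ(Z, ⊤) K (hc.symm.trans ?_)⟩
  rw [IsScalarTower.algebraMap_apply L Γ(Z, ⊤) K]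
  rfl

omit [CharZero k] in
/-- If the square of a leaf `Z` over `L` and a point `y` commutes, it is cartesian: the closed
immersion of `Z` into the fibre at `y` is an isomorphism, since derivations of the fibre extend. -/
theorem isPullback_of_isClosedImmersion [Smooth π] [GeometricallyConnected π] [IsAffine Z]
    [Nonempty Z] {f : Z ⟶ Y} {r : Z ⟶ Spec (CommRingCat.of L)} [Smooth r]
    (hw : f ≫ π = r ≫ y) [IsClosedImmersion (pullback.lift f r hw)]
    (hθ : ∀ U a, diff θ.hom U a = diff q U a)
    {hf : f ≫ p = r ≫ t} {φ : (Scheme.Modules.pullback f).obj G ⟶ cotangentSheaf r} [IsIso φ]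
    (hφ : (Scheme.Modules.pullback f).map q ≫ φ =
      cotangentPullbackMap (r ≫ t) p f hf ≫ relativeCotangentMap r t) :
    IsPullback f r π y := by
  let g := pullback.lift f r hw
  have hP := IsPullback.of_hasPullback π y
  have : AlgebraicGeometry.IsIntegral (pullback π y) := isIntegral_of_isPullback hP
  have H := isPushout_scalarMap hP
  let _ := (scalarMap r ⊤).hom.toAlgebra
  let _ := (scalarMap (pullback.snd π y) ⊤).hom.toAlgebra
  let _ := g.appTop.hom.toAlgebra
  have hLg (c : L) : scalarMap r ⊤ c = g.appTop (scalarMap (pullback.snd π y) ⊤ c) := by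
    have h := scalarMap_app (pullback.snd π y) g ⊤
    have h' : g ≫ pullback.snd π y = r := pullback.lift_snd _ _ _
    rw [h'] at h
    exact congr($h c)
  have hfg (a : Γ(Y, ⊤)) : f.appTop a = g.appTop ((pullback.fst π y).appTop a) := by
    have h' : g ≫ pullback.fst π y = f := pullback.lift_fst _ _ _
    have h := Scheme.Hom.comp_appTop g (pullback.fst π y)
    rw [h'] at h
    exact congr($h a)
  have : IsScalarTower L Γ(pullback π y, ⊤) Γ(Z, ⊤) := .of_algebraMap_eq hLg
  have : Algebra.Smooth L Γ(Z, ⊤) := smooth_scalarMap (isAffineOpen_top Z)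
  have : Algebra.Smooth L Γ(pullback π y, ⊤) := smooth_scalarMap (isAffineOpen_top _)
  have : Nonempty (⊤ : (pullback π y).Opens) := ⟨⟨Nonempty.some inferInstance, trivial⟩⟩
  have : Nonempty (⊤ : Z.Opens) := ⟨⟨Nonempty.some inferInstance, trivial⟩⟩
  have : IsNoetherianRing Γ(pullback π y, ⊤) := Algebra.FiniteType.isNoetherianRing L _
  have : Nontrivial Γ(Z, ⊤) := inferInstance
  have hinj := injective_of_formallySmooth_of_derivation (L := L) (W := Γ(pullback π y, ⊤))
    (C := Γ(Z, ⊤)) (IsClosedImmersion.isAffine_surjective_of_isAffine g).2 (by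
      intro M _ _ _ _ _ _ _ δ
      obtain ⟨D, hD, hD0, hDδ⟩ := exists_leibniz_extension θ hθ hφ M
        (δ.toLinearMap.toAddMonoidHom.comp (pullback.fst π y).appTop.hom.toAddMonoidHom)
        (fun a b ↦ by
          refine (congrArg δ (map_mul (pullback.fst π y).appTop.hom a b)).trans
            ((δ.leibniz _ _).trans ?_)
          rw [hfg, hfg]
          exact congrArg₂ (· + ·) (algebraMap_smul Γ(Z, ⊤) _ _).symm
            (algebraMap_smul Γ(Z, ⊤) _ _).symm)
        (fun b ↦ (congrArg δ congr($(H.w) b)).trans (δ.map_algebraMap _))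
      let D' : Derivation L Γ(Z, ⊤) M :=
        { toFun := D
          map_add' := map_add D
          map_smul' := fun c a ↦ by
            rw [Algebra.smul_def, hD, RingHom.algebraMap_toAlgebra, hD0, smul_zero, add_zero]
            exact algebraMap_smul Γ(Z, ⊤) c (D a)
          map_one_eq_zero' := by
            change D 1 = 0
            rw [← map_one (scalarMap r ⊤).hom, hD0]
          leibniz' := hD }
      refine ⟨D', fun w ↦ ?_⟩
      refine DFunLike.congr_fun (addMonoidHom_eq_of_isPushout (N := M) H
        (D.comp g.appTop.hom.toAddMonoidHom) δ.toLinearMap.toAddMonoidHom (fun a b ↦ ?_)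
        δ.leibniz (fun c ↦ ?_) δ.map_algebraMap fun a ↦ ?_) w
      · refine (congrArg D (map_mul g.appTop.hom a b)).trans ((hD _ _).trans ?_)
        exact congrArg₂ (· + ·) (algebraMap_smul Γ(Z, ⊤) _ _) (algebraMap_smul Γ(Z, ⊤) _ _)
      · exact (congrArg D (hLg c).symm).trans (hD0 c)
      · exact (congrArg D (hfg a).symm).trans (hDδ a))
  have : IsIso g := IsClosedImmersion.isIso_of_injective_of_isAffine hinj
  exact IsPullback.of_iso_pullback ⟨hw⟩ (asIso g) (pullback.lift_fst _ _ _)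
    (pullback.lift_snd _ _ _)

omit [CharZero k] [IsAffine Y] in
/-- A leaf lies over a geometric point of the base: the functions on the base are constant on it. -/
theorem exists_point_comp_eq [IsAlgClosed L] [CharZero L] [IsAffine Z]
    [AlgebraicGeometry.IsIntegral Z] {f : Z ⟶ Y} {r : Z ⟶ Spec (CommRingCat.of L)}
    (hB : ∀ b : B, diff q ⊤ (scalarMap π ⊤ b) = 0)
    {hf : f ≫ p = r ≫ t} {φ : (Scheme.Modules.pullback f).obj G ⟶ cotangentSheaf r}
    (hφ : (Scheme.Modules.pullback f).map q ≫ φ =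
      cotangentPullbackMap (r ≫ t) p f hf ≫ relativeCotangentMap r t) :
    ∃ y : Spec (CommRingCat.of L) ⟶ Spec (CommRingCat.of B), f ≫ π = r ≫ y := by
  choose β₀ hβ₀ using fun b ↦ appTop_mem_range_of_diff_eq_zero hφ _ (hB b)
  have : Nonempty (⊤ : Z.Opens) := ⟨⟨Nonempty.some inferInstance, trivial⟩⟩
  have hrinj : Function.Injective (scalarMap r ⊤).hom := RingHom.injective _
  let β : B →+* L :=
    { toFun := β₀
      map_one' := hrinj <| (hβ₀ 1).symm.trans <| by simp only [map_one]
      map_mul' := fun b c ↦ hrinj <| (hβ₀ _).symm.trans <| by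
        refine Eq.trans ?_ (map_mul (scalarMap r ⊤).hom _ _).symm
        rw [map_mul, map_mul]
        exact congrArg₂ (· * ·) (hβ₀ b) (hβ₀ c)
      map_zero' := hrinj <| (hβ₀ 0).symm.trans <| by simp only [map_zero]
      map_add' := fun b c ↦ hrinj <| (hβ₀ _).symm.trans <| by
        refine Eq.trans ?_ (map_add (scalarMap r ⊤).hom _ _).symm
        rw [map_add, map_add]
        exact congrArg₂ (· + ·) (hβ₀ b) (hβ₀ c) }
  exact ⟨Spec.map (CommRingCat.ofHom β), (comp_eq_comp_of_scalarMap β hβ₀).symm⟩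

/-- Every leaf is the fibre of `π` over a unique geometric point. Uniqueness holds because `Z ⟶ Spec
L` is an epimorphism. -/
theorem existsUnique_point [Smooth π] [GeometricallyConnected π] [IsAlgClosed L]
    (hp : π ≫ pB = p) (hB : ∀ b : B, diff q ⊤ (scalarMap π ⊤ b) = 0)
    (hθ : ∀ U a, diff θ.hom U a = diff q U a) (i : Z ⟶ pullback p t)
    (hi : IsSmoothFamilyOfLeaves q t i) :
    ∃! y : Spec (CommRingCat.of L) ⟶ Spec (CommRingCat.of B), y ≫ pB = t ∧
      IsPullback (i ≫ pullback.fst p t) (i ≫ pullback.snd p t) π y := by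
  have := hi.closedImmersion
  have := hi.smooth
  have := hi.geometricallyIntegral
  obtain ⟨-, φ, hφiso, hφ⟩ := hi.weaklyEtale
  have : IsAffine Z := isAffine_of_isAffineHom i
  have : AlgebraicGeometry.IsIntegral Z := self_of_isIntegral_of_geometrically
    (GeometricallyIntegral.geometrically_isIntegral (f := i ≫ pullback.snd p t))
  have : CharZero L :=
    charZero_of_injective_ringHom (R := k) (Spec.preimage t).hom.injective
  have : Epi (i ≫ pullback.snd p t) := Flat.epi_of_flat_of_surjective _
  obtain ⟨y, hw⟩ := exists_point_comp_eq (π := π) hB hφ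
  have hy : y ≫ pB = t := by
    rw [← cancel_epi (i ≫ pullback.snd p t), ← Category.assoc, ← hw, Category.assoc, hp,
      Category.assoc, pullback.condition, Category.assoc]
  refine ⟨y, ⟨hy, ?_⟩, fun y' ⟨_, hy'⟩ ↦ ?_⟩
  · have hcl := isClosedImmersion_lift hp hy
    have hc : pullback.fst π y ≫ p = pullback.snd π y ≫ t := by
      rw [← hp, ← hy, pullback.condition_assoc]
    have hcomp : pullback.lift _ _ hw ≫
        pullback.lift (f := p) (g := t) (pullback.fst π y) (pullback.snd π y) hc = i := by
      apply pullback.hom_ext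
      · rw [Category.assoc, pullback.lift_fst, pullback.lift_fst]
      · rw [Category.assoc, pullback.lift_snd, pullback.lift_snd]
    have : IsClosedImmersion (pullback.lift _ _ hw ≫
        pullback.lift (f := p) (g := t) (pullback.fst π y) (pullback.snd π y) hc) := by
      rwa [hcomp]
    have := IsClosedImmersion.of_comp_isClosedImmersion (pullback.lift _ _ hw)
      (pullback.lift (f := p) (g := t) (pullback.fst π y) (pullback.snd π y) hc)
    exact isPullback_of_isClosedImmersion θ hw hθ hφ
  · rw [← cancel_epi (i ≫ pullback.snd p t), ← hw, hy'.w]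

omit [IsAffine Y] in
/-- The composite of `d` with the pullback of differentials from the base vanishes. -/
theorem isInvariantMorphism (hp : π ≫ pB = p) (hB : ∀ b : B, diff q ⊤ (scalarMap π ⊤ b) = 0) :
    IsInvariantMorphism q π hp := by
  refine ⟨universallySeparable_of_charZero π pB, 0, ?_⟩
  refine map_comp_eq_cotangentPullbackMap_comp_of_isAffine π hp _ _ _ fun a ↦ ?_
  obtain ⟨b, rfl⟩ :=
    (Scheme.ΓSpecIso (CommRingCat.of B)).symm.commRingCatIsoToRingEquiv.surjective a
  have h := hB b
  rw [scalarMap_top] at h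
  refine Eq.trans ?_ h.symm
  have h0 := (isZero_zero (Spec (CommRingCat.of B)).Modules).eq_of_src
    (((Scheme.Modules.pullbackPushforwardAdjunction π).homEquiv _ G) 0) 0
  rw [h0]
  rfl

end Leaves

/-! ### The geometric quotient in the affine case -/

section GeometricQuotient

variable {k B : Type u} [Field k] [CharZero k] [CommRing B] {Y : Scheme.{u}} [IsAffine Y]
  [AlgebraicGeometry.IsIntegral Y]
  {p : Y ⟶ Spec (CommRingCat.of k)} {π : Y ⟶ Spec (CommRingCat.of B)}
  {pB : Spec (CommRingCat.of B) ⟶ Spec (CommRingCat.of k)} {M : Y.Modules}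

/-- The affine case: `Y` is integral and affine, the base `Spec B` consists of first integrals, and
`π` is smooth of relative dimension the rank of `M`, with geometrically connected fibres. -/
theorem isGeometricQuotient (hp : π ≫ pB = p) (q : cotangentSheaf p ⟶ M) [Epi q] {n : ℕ}
    [SmoothOfRelativeDimension n π] [GeometricallyConnected π]
    (hinj : Function.Injective (scalarMap π ⊤)) (hB : ∀ b : B, diff q ⊤ (scalarMap π ⊤ b) = 0)
    (hn : Module.finrank (Y.presheaf.stalk (genericPoint Y))
      (M.presheaf.stalk (genericPoint Y)) = n) :
    IsGeometricQuotient q pB π := by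
  have : Smooth π := SmoothOfRelativeDimension.smooth n π
  have : Nonempty (⊤ : Y.Opens) := ⟨⟨genericPoint Y, trivial⟩⟩
  have : Nontrivial B := (scalarMap π ⊤).hom.domain_nontrivial
  have : CharZero B := charZero_of_injective_ringHom (R := k) (Spec.preimage pB).hom.injective
  obtain ⟨θ, hθ⟩ := exists_cotangentSheaf_iso q hB hn
  exact
    { comp_eq := hp
      invariant := isInvariantMorphism hp hB
      representsLeaves :=
        { fibre_isLeaf := fun L _ _ t y hy ↦ by
            have := isClosedImmersion_lift hp hy
            refine isSmoothFamilyOfLeaves_of_isPullback (y := y) θ hθ _ ?_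
            rw [pullback.lift_fst, pullback.lift_snd]
            exact IsPullback.of_hasPullback π y
          existsUnique_point := fun L _ _ t Z i hi ↦ existsUnique_point θ hp hB hθ i hi }
      universallyOpen := inferInstance
      injective_stalkMap := fun x ↦ stalkMap_injective π x
      range_stalkMap := range_stalkMap_eq q hinj hB
        (exists_injective_kaehlerDifferential_stalk_map q hB hn) }

end GeometricQuotient

/-! ### Restriction to an open subscheme -/

section Restriction

variable {k : Type u} [CommRing k] {X : Scheme.{u}} {p : X ⟶ Spec (CommRingCat.of k)}
  {M : X.Modules} (q : cotangentSheaf p ⟶ M) (U : X.Opens)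

theorem diff_restrictQuotient (W : (U : Scheme.{u}).Opens) (a : Γ(U, W)) :
    diff (restrictQuotient q U) W a = diff q (U.ι ''ᵁ W) ((U.ι.appIso W).inv a) :=
  diff_cotangentDesc _ _ _

theorem diff_restrictQuotient_app (V : X.Opens) (a : Γ(X, V)) :
    diff (restrictQuotient q U) (U.ι ⁻¹ᵁ V) (U.ι.app V a) =
      M.presheaf.map (homOfLE (U.ι.image_preimage_le V)).op (diff q V a) := by
  rw [diff_restrictQuotient, ← diff_res]
  congr 1
  exact congr($(U.ι.app_appIso_inv V) a)

/-- By the adjunction between restriction and direct image, a map out of `M|_U` is determined by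
its values on the sections `(q ∘ d) a` with `a` defined on an open subset of `X`. -/
instance epi_restrictQuotient [Epi q] : Epi (restrictQuotient q U) :=
  Preadditive.epi_of_cancel_zero _ fun {N} g hg ↦ by
    let h := (Scheme.Modules.restrictAdjunction U.ι).homEquiv _ _ g
    have hh : h = 0 := by
      refine hom_ext_of_epi q fun V a ↦ ?_
      have h1 : diff (restrictQuotient q U) (U.ι ⁻¹ᵁ V) (U.ι.app V a) =
          M.presheaf.map (homOfLE (U.ι.image_preimage_le V)).op (diff q V a) :=
        diff_restrictQuotient_app q U V a
      have h2 : g.app (U.ι ⁻¹ᵁ V) (diff (restrictQuotient q U) (U.ι ⁻¹ᵁ V) (U.ι.app V a)) = 0 := by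
        rw [← diff_comp, hg]; rfl
      rw [h1] at h2
      exact h2
    exact ((Scheme.Modules.restrictAdjunction U.ι).homEquiv _ _).injective
      (hh.trans (by simp [Adjunction.homEquiv_unit]))

theorem stalkIso_hom_germ (x : (U : Scheme.{u})) (W : (U : Scheme.{u}).Opens) (hx : x ∈ W)
    (a : Γ(U, W)) :
    (U.stalkIso x).hom ((U : Scheme.{u}).presheaf.germ W x hx a) =
      X.presheaf.germ (U.ι ''ᵁ W) (U.ι x) ⟨x, hx, rfl⟩ ((U.ι.appIso W).inv a) := by
  rw [Scheme.Opens.ι_appIso]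
  exact congr($(U.germ_stalkIso_hom x hx) a)

/-- Restriction to an open subscheme identifies the stalks of modules, semilinearly with respect
to the identification of local rings. -/
theorem exists_addEquiv_stalk_restrict (M : X.Modules) (x : (U : Scheme.{u})) :
    ∃ e : (M.restrict U.ι).presheaf.stalk x ≃+ M.presheaf.stalk (U.ι x),
      (∀ (W : (U : Scheme.{u}).Opens) (hx : x ∈ W) (m : Γ(M.restrict U.ι, W)),
        e ((M.restrict U.ι).presheaf.germ W x hx m) =
          M.presheaf.germ (U.ι ''ᵁ W) (U.ι x) ⟨x, hx, rfl⟩ m) ∧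
      ∀ (s : (U : Scheme.{u}).presheaf.stalk x) (m : (M.restrict U.ι).presheaf.stalk x),
        e (s • m) = (show X.presheaf.stalk (U.ι x) from (U.stalkIso x).hom s) • e m := by
  let e : (M.restrict U.ι).presheaf.stalk x ≅ M.presheaf.stalk (U.ι x) :=
    (Scheme.Modules.restrictStalkNatIso U.ι x).app M
  have he (W : (U : Scheme.{u}).Opens) (hx : x ∈ W) (m : Γ(M.restrict U.ι, W)) :
      e.hom ((M.restrict U.ι).presheaf.germ W x hx m) =
        M.presheaf.germ (U.ι ''ᵁ W) (U.ι x) ⟨x, hx, rfl⟩ m :=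
    congr($(Scheme.Modules.germ_restrictStalkNatIso_hom_app U.ι x M hx) m)
  refine ⟨e.addCommGroupIsoToAddEquiv, he, fun s m ↦ ?_⟩
  obtain ⟨V, hV, a, rfl⟩ := TopCat.Presheaf.exists_germ_eq _ s
  obtain ⟨W, hW, b, rfl⟩ := TopCat.Presheaf.exists_germ_eq _ m
  have hVW : x ∈ V ⊓ W := ⟨hV, hW⟩
  let i : V ⊓ W ⟶ V := homOfLE inf_le_left
  let j : V ⊓ W ⟶ W := homOfLE inf_le_right
  rw [← TopCat.Presheaf.germ_res_apply _ i x hVW a,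
    ← TopCat.Presheaf.germ_res_apply _ j x hVW b]
  generalize (U : Scheme.{u}).presheaf.map i.op a = a'
  generalize (M.restrict U.ι).presheaf.map j.op b = b'
  have h1 := stalkIso_hom_germ U x (V ⊓ W) hVW a'
  have h2 := he (V ⊓ W) hVW b'
  refine (congrArg e.hom (germ_smul _ x (V ⊓ W) hVW a' b').symm).trans
    ((he _ _ _).trans (Eq.trans ?_ (congrArg₂ (fun (r : X.presheaf.stalk (U.ι x))
      (n : M.presheaf.stalk (U.ι x)) ↦ r • n) h1 h2).symm))
  exact germ_smul M (U.ι x) (U.ι ''ᵁ (V ⊓ W)) ⟨x, hVW, rfl⟩ ((U.ι.appIso (V ⊓ W)).inv a') b'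

theorem finrank_stalk_restrict (M : X.Modules) (x : (U : Scheme.{u})) :
    Module.finrank ((U : Scheme.{u}).presheaf.stalk x) ((M.restrict U.ι).presheaf.stalk x) =
      Module.finrank (X.presheaf.stalk (U.ι x)) (M.presheaf.stalk (U.ι x)) := by
  obtain ⟨e, -, he⟩ := exists_addEquiv_stalk_restrict U M x
  exact congrArg Cardinal.toNat (rank_eq_of_equiv_equiv (U.stalkIso x).hom e
    (U.stalkIso x).commRingCatIsoToRingEquiv.bijective he)

theorem mem_localFirstIntegrals_restrictQuotient (x : (U : Scheme.{u}))
    (s : (U : Scheme.{u}).presheaf.stalk x) :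
    s ∈ localFirstIntegrals (restrictQuotient q U) x ↔
      (U.stalkIso x).hom s ∈ localFirstIntegrals q (U.ι x) := by
  obtain ⟨e, he, -⟩ := exists_addEquiv_stalk_restrict U M x
  constructor
  · rintro ⟨W, hx, a, rfl, h⟩
    refine ⟨U.ι ''ᵁ W, ⟨x, hx, rfl⟩, (U.ι.appIso W).inv a, (stalkIso_hom_germ U x W hx a).symm, ?_⟩
    rw [← diff_restrictQuotient]
    exact (he W hx _).symm.trans (by rw [h, map_zero])
  · rintro ⟨W, hx, a, ha, h⟩
    have hle := U.ι.image_preimage_le W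
    refine ⟨U.ι ⁻¹ᵁ W, hx, U.ι.app W a, ?_, ?_⟩
    · refine (U.stalkIso x).commRingCatIsoToRingEquiv.injective ?_
      refine (stalkIso_hom_germ U x _ hx _).trans (Eq.trans ?_ ha)
      refine (congrArg _ (congr($(U.ι.app_appIso_inv W) a))).trans ?_
      exact TopCat.Presheaf.germ_res_apply X.presheaf (homOfLE hle) (U.ι x) _ a
    · refine e.injective ((he _ _ _).trans ?_)
      rw [diff_restrictQuotient_app]
      exact (TopCat.Presheaf.germ_res_apply M.presheaf (homOfLE hle) (U.ι x) _ _).trans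
        (h.trans (map_zero e).symm)

end Restriction

section FirstIntegrals

variable {k : Type u} [CommRing k] {X : Scheme.{u}} {p : X ⟶ Spec (CommRingCat.of k)}
  {M : X.Modules} (q : cotangentSheaf p ⟶ M) (U : X.Opens)

theorem scalarMap_toFirstIntegralsSpec :
    scalarMap (toFirstIntegralsSpec q U) ⊤ =
      CommRingCat.ofHom (firstIntegrals q U).subtype ≫ U.topIso.inv := by
  rw [scalarMap_top, toFirstIntegralsSpec, Scheme.Hom.comp_appTop, Scheme.Opens.toSpecΓ_appTop,
    ← Scheme.ΓSpecIso_inv_naturality_assoc]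
  exact congr(_ ≫ $(Iso.inv_hom_id_assoc _ _))

theorem toFirstIntegralsSpec_comp :
    toFirstIntegralsSpec q U ≫ firstIntegralsSpecOver q U = U.ι ≫ p := by
  have h : CommRingCat.ofHom (firstIntegralsScalar q U) ≫
      CommRingCat.ofHom (firstIntegrals q U).subtype = scalarMap p U := rfl
  rw [toFirstIntegralsSpec, firstIntegralsSpecOver, Category.assoc, ← Spec.map_comp, h]
  rw [scalarMap, Spec.map_comp, Spec.map_comp, Category.assoc,
    Scheme.Opens.toSpecΓ_SpecMap_presheaf_map_top_assoc,
    ← Scheme.toSpecΓ_naturality_assoc, ← SpecMap_ΓSpecIso_hom, ← Spec.map_comp, Iso.inv_hom_id,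
    Spec.map_id, Category.comp_id]

theorem diff_scalarMap_toFirstIntegralsSpec (b : firstIntegrals q U) :
    diff (restrictQuotient q U) ⊤ (scalarMap (toFirstIntegralsSpec q U) ⊤ b) = 0 := by
  rw [diff_restrictQuotient, scalarMap_toFirstIntegralsSpec, Scheme.Opens.ι_appIso]
  refine (diff_res q (eqToHom U.ι_image_top) b.1).trans ?_
  rw [show diff q U b.1 = 0 from b.2, map_zero]
  rfl

end FirstIntegrals

end Foliation

theorem proposition4p25 {k : Type u} [Field k] [CharZero k] {X : Scheme.{u}}
    (p : X ⟶ Spec (CommRingCat.of k)) [IsIntegral X] [LocallyOfFiniteType p]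
    (hnormal : ∀ x : X, IsIntegrallyClosed (X.presheaf.stalk x))
    (F : Foliation.Distribution p) (hfol : F.IsInvolutive) (hint : F.IsAlgebraicallyIntegrable)
    (hft : F.HasFiniteTypeFirstIntegrals)
    (x : X) (U : X.Opens) (hx : x ∈ U) (hU : F.WitnessesStability U) :
    Foliation.IsGeometricQuotient (Foliation.restrictQuotient F.quotientMap U)
        (Foliation.firstIntegralsSpecOver F.quotientMap U)
        (Foliation.toFirstIntegralsSpec F.quotientMap U) ∧
      ∀ y : U,
        Function.Injective
          ((Foliation.toFirstIntegralsSpec F.quotientMap U).stalkMap y ≫ (U.stalkIso y).hom) ∧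
        ((Foliation.toFirstIntegralsSpec F.quotientMap U).stalkMap y ≫
            (U.stalkIso y).hom).hom.range =
          Foliation.localFirstIntegrals F.quotientMap (y : X) := by
  have : IsAffine (U : Scheme.{u}) := hU.isAffineOpen
  have : Nonempty U := ⟨⟨x, hx⟩⟩
  have : Nonempty (U : Scheme.{u}) := ⟨⟨x, hx⟩⟩
  have : IsIntegral (U : Scheme.{u}) := inferInstance
  have := F.epi
  have := hU.smooth
  have := hU.geometricallyConnected
  have hn : Module.finrank ((U : Scheme.{u}).presheaf.stalk (genericPoint U))
      ((F.sheaf.restrict U.ι).presheaf.stalk (genericPoint U)) = F.rank := by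
    rw [Foliation.finrank_stalk_restrict U F.sheaf (genericPoint U),
      genericPoint_eq_of_isOpenImmersion U.ι]
    rfl
  have hinj : Function.Injective
      (Foliation.scalarMap (Foliation.toFirstIntegralsSpec F.quotientMap U) ⊤) := by
    rw [Foliation.scalarMap_toFirstIntegralsSpec]
    exact U.topIso.symm.commRingCatIsoToRingEquiv.injective.comp Subtype.val_injective
  have H := Foliation.isGeometricQuotient
    (Foliation.toFirstIntegralsSpec_comp F.quotientMap U)
    (Foliation.restrictQuotient F.quotientMap U) hinj
    (Foliation.diff_scalarMap_toFirstIntegralsSpec F.quotientMap U) hn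
  refine ⟨H, fun y ↦ ⟨?_, ?_⟩⟩
  · exact (U.stalkIso y).commRingCatIsoToRingEquiv.injective.comp (H.injective_stalkMap y)
  · ext s
    have hs := Foliation.mem_localFirstIntegrals_restrictQuotient F.quotientMap U y
    constructor
    · rintro ⟨b, rfl⟩
      exact (hs _).1 ((H.range_stalkMap y).le ⟨b, rfl⟩)
    · intro h
      obtain ⟨s, rfl⟩ := (U.stalkIso y).commRingCatIsoToRingEquiv.surjective s
      obtain ⟨b, rfl⟩ := (H.range_stalkMap y).ge ((hs s).2 h)
      exact ⟨b, rfl⟩
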